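/- Let $b\ge 1$ be an integer. A \emph{bucket increasing tree} of size $n\ge 1$ with maximal bucket size $b$ is an unordered rooted tree whose nodes $v$ (buckets) hold $c(v)$ labels each, $1\le c(v)\le b$, where the labels $1,\dots,n$ are distributed among the nodes, the labels in a child bucket are all larger than those in its parent bucket, and every internal node is saturated, i.e. satisfies $c(v)=b$. Let $\deg^+(v)$ be the out-degree of $v$. Random trees are grown as follows: start with a single bucket containing label $1$; given a tree of size $n$, a node $v$ attracts label $n+1$ with probability $p(v)$, and then label $n+1$ is added to $v$ if $c(v)<b$, and otherwise forms a new bucket of capacity $1$ attached to $v$ as a child. Here $$p(v)=\frac{(d-1)c(v)+1-\deg^+(v)}{(d-1)n+1}\quad\text{for }(b,d)\text{-ary increasing trees } (d\ge 2\text{ an integer}),$$ $$p(v)=\frac{\deg^+(v)+(\alpha+1)c(v)-1}{(\alpha+1)n-1}\quad\text{for }(b,\alpha)\text{-plane oriented recursive trees } (\alpha>0\text{ real}).$$ Put $\kappa=\frac1{d-1}$ in the first case and $\kappa=-\frac1{\alpha+1}$ in the second, and let $K_n$ be the size of the bucket containing label $n$ in the random tree of size $n$. Let $\lambda_1,\dots,\lambda_b\in\mathbb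 C$ be the roots, counted with multiplicity, of the indicial equation $\lambda^{\overline b}=(b+\kappa)^{\underline b}$, where $x^{\overline b}=x(x+1)\cdots(x+b-1)$ and $x^{\underline b}=x(x-1)\cdots(x-b+1)$. Write $\binom{x}{k}=x^{\underline k}/k!$ and $H_{x+k}-H_x=\sum_{j=1}^k\frac1{j+x}$. (1) For $(b,d)$-ary increasing trees the roots $\lambda_i$ are pairwise distinct. For $(b,\alpha)$-plane oriented recursive trees they are pairwise distinct whenever $\alpha\ge 1$, and, for each fixed $b$, for all but finitely many $\alpha>0$. (2) Whenever the roots are pairwise distinct, for all $n\ge 1$ and $1\le m\le b$, $$\mathbb P\{K_n=m\}=\sum_{i=1}^{b}\frac{\binom{\lambda_i+n-2}{n-1}\binom{\lambda_i+b-1}{b-m}\binom{m-1+\kappa}{m-1}}{\binom{n-1+\kappa}{n-1}\binom{b}{m-1}(b-m+1)\binom{b+\kappa}{b}\,(H_{\lambda_i+b-1}-H_{\lambda_i-1})}.$$ (3) For all $d\ge2$, respectively all $\alpha>0$, $K_n$ converges in distribution, as $n\to\infty$, to a random variable $K$ with values in $\{1,\dots,b\}$ and $$\mathbb P\{K=m\}=\frac{\binom{b+\kappa}{b-m}\binom{m-1+\kappa}{m-1}}{\binom{b}{m-1}(b-m+1)\binom{b+\kappa}{b}\,(H_{b+\kappa}-H_{\kappa})},\qquad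 1\le m\le b.$$ -/

import Mathlib

open Filter Topology MeasureTheory Finset

/-- An (unordered) bucket increasing tree of size `n` with maximal bucket size `b`.
The labels `1, …, n` are the elements of `Fin n` (shifted by one), and every bucket (node) is
identified with the smallest label that it contains.  `head i` is the bucket containing label `i`;
`parent i` is the parent of the bucket containing `i` (`none` if this bucket is the root). -/
@[ext]
structure BucketTree (b n : ℕ) where
  head : Fin n → Fin n
  parent : Fin n → Option (Fin n)
  head_head : ∀ i, head (head i) = head i
  head_le : ∀ i, head i ≤ i
  /-- every bucket holds at most `b` labels -/
  card_le : ∀ v, (univ.filter fun j => head j = v).card ≤ b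
  parent_head : ∀ i, parent (head i) = parent i
  /-- the root is the bucket containing the smallest label -/
  parent_eq_none : ∀ i, parent i = none ↔ (head i : ℕ) = 0
  /-- parents are buckets -/
  head_parent : ∀ i u, parent i = some u → head u = u
  /-- labels increase along the edges: each label in the parent bucket is smaller than all labels
  of the child bucket -/
  increasing : ∀ i u j, parent i = some u → head j = u → j < head i
  /-- internal nodes are saturated -/
  saturated : ∀ i u, parent i = some u → (univ.filter fun j => head j = u).card = b

namespace BucketTree

variable {b n : ℕ}

noncomputable instance : Fintype (BucketTree b n) :=
  haveI : Finite (BucketTree b n) :=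
    Finite.of_injective (fun T : BucketTree b n => (T.head, T.parent)) (by
      intro S T h
      simp only [Prod.mk.injEq] at h
      exact BucketTree.ext h.1 h.2)
  Fintype.ofFinite _

instance : MeasurableSpace (BucketTree b n) := ⊤

/-- The buckets (nodes) of a tree. -/
abbrev Bucket (T : BucketTree b n) : Type := {v : Fin n // T.head v = v}

/-- The capacity `c(v)`: the number of labels in the bucket `v`. -/
def capacity (T : BucketTree b n) (v : Fin n) : ℕ :=
  (univ.filter fun j => T.head j = v).card

/-- The out-degree of `v`: the number of buckets whose parent is `v`. -/
def outdegree (T : BucketTree b n) (v : Fin n) : ℕ :=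
  (univ.filter fun w => T.head w = w ∧ T.parent w = some v).card

lemma one_le_capacity (T : BucketTree b n) (v : T.Bucket) : 1 ≤ T.capacity v :=
  Finset.card_pos.2 ⟨v.1, by simp [v.2]⟩

lemma outdegree_eq_zero (T : BucketTree b n) (v : Fin n) (h : T.capacity v < b) :
    T.outdegree v = 0 := by
  unfold outdegree
  rw [Finset.card_eq_zero, Finset.filter_eq_empty_iff]
  rintro w - ⟨-, hw⟩
  have := T.saturated w v hw
  unfold capacity at h
  omega

lemma parent_ne_of_capacity_lt (T : BucketTree b n) (v i : Fin n) (h : T.capacity v < b) :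
    T.parent i ≠ some v := by
  intro hw
  have := T.saturated i v hw
  unfold capacity at h
  omega

/-- `T.insert v` is the tree obtained when the bucket `v` attracts the next label: the label is
added to `v` if `v` is unsaturated; otherwise it forms a new bucket of capacity one that is
attached to `v` as a child. -/
def insert (T : BucketTree b n) (v : T.Bucket) : BucketTree b (n + 1) where
  head := Fin.snoc (α := fun _ => Fin (n + 1)) (fun i => (T.head i).castSucc)
    (if T.capacity v < b then v.1.castSucc else Fin.last n)
  parent := Fin.snoc (α := fun _ => Option (Fin (n + 1))) (fun i => (T.parent i).map Fin.castSucc)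
    (if T.capacity v < b then (T.parent v).map Fin.castSucc else some v.1.castSucc)
  head_head := by
    intro i
    refine Fin.lastCases ?_ (fun i => ?_) i
    · by_cases h : T.capacity v < b <;> simp [h, v.2]
    · simp [T.head_head]
  head_le := by
    intro i
    refine Fin.lastCases ?_ (fun i => ?_) i
    · exact Fin.le_last _
    · simpa using T.head_le i
  card_le := by
    intro u
    rw [Finset.card_filter, Fin.sum_univ_castSucc]
    simp only [Fin.snoc_castSucc, Fin.snoc_last]
    refine Fin.lastCases ?_ (fun u => ?_) u
    · have hb : 1 ≤ b := (T.one_le_capacity v).trans (T.card_le v)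
      by_cases h : T.capacity v < b <;> simp [h, Fin.castSucc_ne_last, hb]
    · simp only [Fin.castSucc_inj, ← Finset.card_filter]
      have h1 := T.card_le u
      by_cases h : T.capacity v < b
      · by_cases huv : v.1 = u
        · subst huv
          unfold capacity at h
          simp [capacity, h]
        · simpa [h, huv] using h1
      · simpa [h, (Fin.castSucc_ne_last u).symm] using h1
  parent_head := by
    intro i
    refine Fin.lastCases ?_ (fun i => ?_) i
    · by_cases h : T.capacity v < b <;> simp [h]
    · simp [T.parent_head]
  parent_eq_none := by
    intro i
    have hn : n ≠ 0 := by have := v.1.isLt; omega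
    refine Fin.lastCases ?_ (fun i => ?_) i
    · by_cases h : T.capacity v < b
      · simpa [h, v.2] using T.parent_eq_none v
      · simp [h, hn]
    · simpa using T.parent_eq_none i
  head_parent := by
    intro i u
    refine Fin.lastCases ?_ (fun i => ?_) i
    · by_cases h : T.capacity v < b
      · simp only [Fin.snoc_last, h, if_true, Option.map_eq_some_iff]
        rintro ⟨w, hw, rfl⟩
        simpa using T.head_parent _ _ hw
      · simp only [Fin.snoc_last, h, if_false, Option.some.injEq]
        rintro rfl
        simpa using v.2
    · simp only [Fin.snoc_castSucc, Option.map_eq_some_iff]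
      rintro ⟨w, hw, rfl⟩
      simpa using T.head_parent _ _ hw
  increasing := by
    intro i u j
    refine Fin.lastCases ?_ (fun i => ?_) i
    · by_cases h : T.capacity v < b
      · simp only [Fin.snoc_last, h, if_true, Option.map_eq_some_iff]
        rintro ⟨w, hw, rfl⟩
        refine Fin.lastCases ?_ (fun j => ?_) j
        · simp only [Fin.snoc_last, Fin.castSucc_inj]
          intro hvw
          exact absurd (hvw ▸ hw) (T.parent_ne_of_capacity_lt v v h)
        · simp only [Fin.snoc_castSucc, Fin.castSucc_inj, Fin.castSucc_lt_castSucc_iff]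
          intro hj
          simpa [v.2] using T.increasing _ _ j hw hj
      · simp only [Fin.snoc_last, h, if_false, Option.some.injEq]
        rintro rfl
        refine Fin.lastCases ?_ (fun j => ?_) j
        · simp [(Fin.castSucc_ne_last v.1).symm]
        · simp
    · simp only [Fin.snoc_castSucc, Option.map_eq_some_iff]
      rintro ⟨w, hw, rfl⟩
      refine Fin.lastCases ?_ (fun j => ?_) j
      · by_cases h : T.capacity v < b
        · simp only [Fin.snoc_last, h, if_true, Fin.castSucc_inj]
          intro hvw
          exact absurd (hvw ▸ hw) (T.parent_ne_of_capacity_lt v i h)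
        · simp [h, (Fin.castSucc_ne_last w).symm]
      · simp only [Fin.snoc_castSucc, Fin.castSucc_inj, Fin.castSucc_lt_castSucc_iff]
        exact T.increasing _ _ j hw
  saturated := by
    have key : ∀ w : Fin n, (univ.filter fun j => T.head j = w).card = b →
        (univ.filter fun j => Fin.snoc (α := fun _ => Fin (n + 1)) (fun i => (T.head i).castSucc)
          (if T.capacity v < b then v.1.castSucc else Fin.last n) j = w.castSucc).card = b := by
      intro w hw
      rw [Finset.card_filter, Fin.sum_univ_castSucc]
      simp only [Fin.snoc_castSucc, Fin.snoc_last, Fin.castSucc_inj, ← Finset.card_filter, hw]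
      by_cases h : T.capacity v < b
      · have : v.1 ≠ w := by
          rintro rfl
          unfold capacity at h
          omega
        simp [h, this]
      · simp [h, (Fin.castSucc_ne_last w).symm]
    intro i u
    refine Fin.lastCases ?_ (fun i => ?_) i
    · by_cases h : T.capacity v < b
      · simp only [Fin.snoc_last, h, if_true, Option.map_eq_some_iff]
        rintro ⟨w, hw, rfl⟩
        have := key w (T.saturated _ _ hw)
        simpa only [h, if_true] using this
      · have hv : (univ.filter fun j => T.head j = v.1).card = b :=
          le_antisymm (T.card_le v) (not_lt.1 h)
        simp only [Fin.snoc_last, h, if_false, Option.some.injEq]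
        rintro rfl
        have := key v.1 hv
        simpa only [h, if_false] using this
    · simp only [Fin.snoc_castSucc, Option.map_eq_some_iff]
      rintro ⟨w, hw, rfl⟩
      exact key w (T.saturated _ _ hw)

lemma sum_capacity (T : BucketTree b n) : ∑ v : T.Bucket, T.capacity v = n := by
  have h := Finset.card_eq_sum_card_fiberwise (s := (univ : Finset (Fin n)))
    (t := univ.filter fun v => T.head v = v) (f := T.head)
    (by intro i _; simp [T.head_head])
  rw [Finset.card_univ, Fintype.card_fin] at h
  conv_rhs => rw [h]
  exact Finset.sum_subtype (p := fun v => T.head v = v) _ (by simp)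
    (fun v => T.capacity v) |>.symm

lemma sum_outdegree (T : BucketTree b (n + 1)) :
    ∑ v : T.Bucket, T.outdegree v + 1 = Fintype.card T.Bucket := by
  have h0 : T.head 0 = 0 := le_antisymm (T.head_le 0) (Fin.zero_le _)
  have hroot : ∀ w, T.head w = w → (T.parent w = none ↔ w = 0) := by
    intro w hw
    rw [T.parent_eq_none, hw, Fin.ext_iff, Fin.val_zero]
  have h := Finset.card_eq_sum_card_fiberwise
    (s := univ.filter fun w => T.head w = w ∧ w ≠ 0)
    (t := univ.filter fun v => T.head v = v) (f := fun w => (T.parent w).getD 0)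
    (by
      intro w hw
      simp only [coe_filter, mem_univ, true_and, Set.mem_ofPred_eq] at hw ⊢
      cases hp : T.parent w with
      | none => simpa using h0
      | some u => simpa using T.head_parent w u hp)
  have h1 : (univ.filter fun w => T.head w = w ∧ w ≠ 0).card + 1 = Fintype.card T.Bucket := by
    rw [Fintype.card_subtype, ← Finset.card_erase_add_one (a := (0 : Fin (n + 1)))
      (s := univ.filter fun v => T.head v = v) (by simpa using h0)]
    congr 2
    ext w
    simp [and_comm]
  rw [← h1, h, ← Finset.sum_subtype (p := fun v => T.head v = v)
    (univ.filter fun v => T.head v = v) (by simp) (fun v => T.outdegree v)]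
  congr 1
  refine Finset.sum_congr rfl fun v _ => ?_
  unfold outdegree
  congr 1
  ext w
  simp only [mem_filter, mem_univ, true_and]
  constructor
  · rintro ⟨hw, hp⟩
    refine ⟨⟨hw, fun h => ?_⟩, by simp [hp]⟩
    rw [(hroot w hw).2 h] at hp
    cases hp
  · rintro ⟨⟨hw, hne⟩, hp⟩
    refine ⟨hw, ?_⟩
    cases hq : T.parent w with
    | none => exact absurd ((hroot w hw).1 hq) hne
    | some u => simpa [hq] using hp

lemma capacity_insert (T : BucketTree b n) (v : T.Bucket) (u : Fin n) :
    (T.insert v).capacity u.castSucc =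
      T.capacity u + if T.capacity v < b ∧ v.1 = u then 1 else 0 := by
  have hins : (T.insert v).head = Fin.snoc (α := fun _ => Fin (n + 1))
    (fun i => (T.head i).castSucc)
    (if T.capacity v < b then v.1.castSucc else Fin.last n) := rfl
  rw [capacity, hins, Finset.card_filter, Fin.sum_univ_castSucc]
  simp only [Fin.snoc_castSucc, Fin.snoc_last, Fin.castSucc_inj, ← Finset.card_filter]
  change T.capacity u + _ = _
  by_cases h : T.capacity v < b
  · simp [h]
  · simp [h, (Fin.castSucc_ne_last u).symm]

lemma outdegree_insert (T : BucketTree b n) (v : T.Bucket) (u : Fin n) :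
    (T.insert v).outdegree u.castSucc =
      T.outdegree u + if ¬ T.capacity v < b ∧ v.1 = u then 1 else 0 := by
  unfold outdegree
  rw [Finset.card_filter, Fin.sum_univ_castSucc]
  simp only [insert, Fin.snoc_castSucc, Fin.snoc_last, Fin.castSucc_inj]
  by_cases h : T.capacity v < b
  · simp [h, Fin.castSucc_ne_last, Option.map_eq_some_iff, Fin.castSucc_inj]
  · simp [h, Option.map_eq_some_iff, Fin.castSucc_inj]

lemma outdegree_insert_last (T : BucketTree b n) (v : T.Bucket) :
    (T.insert v).outdegree (Fin.last n) = 0 := by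
  unfold outdegree
  rw [Finset.card_eq_zero, Finset.filter_eq_empty_iff]
  rintro w - ⟨-, hw⟩
  revert hw
  refine Fin.lastCases ?_ (fun w => ?_) w
  · by_cases h : T.capacity v < b
    · simp [insert, h, Fin.castSucc_ne_last]
    · simp [insert, h, Fin.castSucc_ne_last]
  · simp [insert, Fin.castSucc_ne_last]

/-- If `b ≥ 1`, there is exactly one tree of size one: a single bucket containing the label `1`. -/
lemma unique_one (hb : 1 ≤ b) : Nonempty (Unique (BucketTree b 1)) := ⟨{
  default :=
    { head := id
      parent := fun _ => none
      head_head := fun _ => rfl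
      head_le := fun _ => le_rfl
      card_le := fun v => (Finset.card_le_univ _).trans (by simpa using hb)
      parent_head := fun _ => rfl
      parent_eq_none := fun i => by simp
      head_parent := fun i u h => by cases h
      increasing := fun i u j h => by cases h
      saturated := fun i u h => by cases h }
  uniq := fun T => by
    ext i
    · simp
    · have : T.parent i = none := (T.parent_eq_none i).2 (by have := (T.head i).isLt; omega)
      simp [this] }⟩

open Classical in
/-- The distribution of the random tree produced by a stochastic growth rule.
`p n c k` is the probability that, in a tree of size `n`, a bucket of capacity `c` and
out-degree `k` attracts the next label.  `growthMass p n T` is the probability of the tree `T`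
of size `n + 1`: one starts with the unique tree of size one, and from a tree `T` one passes to
`T.insert v` with probability `p (size of T) c(v) deg(v)`. -/
noncomputable def growthMass (p : ℕ → ℕ → ℕ → ℝ) : (n : ℕ) → BucketTree b (n + 1) → ℝ
  | 0, _ => 1
  | n + 1, T' =>
      ∑ T : BucketTree b (n + 1), ∑ v : T.Bucket,
        if T.insert v = T' then growthMass p n T * p (n + 1) (T.capacity v) (T.outdegree v) else 0

/-- Growth rule of `(b,d)`-ary increasing trees. -/
noncomputable def daryRule (d : ℕ) (n c k : ℕ) : ℝ :=
  (((d : ℝ) - 1) * c + 1 - k) / (((d : ℝ) - 1) * n + 1)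

/-- Growth rule of `(b,α)`-plane oriented recursive trees. -/
noncomputable def portRule (α : ℝ) (n c k : ℕ) : ℝ :=
  (k + (α + 1) * c - 1) / ((α + 1) * n - 1)

lemma sum_daryRule {d : ℕ} (hd : 2 ≤ d) (T : BucketTree b (n + 1)) :
    ∑ v : T.Bucket, daryRule d (n + 1) (T.capacity v) (T.outdegree v) = 1 := by
  have h1 : (∑ v : T.Bucket, (T.capacity v : ℝ)) = ((n + 1 : ℕ) : ℝ) := by
    exact_mod_cast T.sum_capacity
  have h2 : (∑ v : T.Bucket, (T.outdegree v : ℝ)) + 1 = Fintype.card T.Bucket := by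
    exact_mod_cast T.sum_outdegree
  have hd' : (2 : ℝ) ≤ d := by exact_mod_cast hd
  have hpos : 0 < ((d : ℝ) - 1) * ((n + 1 : ℕ) : ℝ) + 1 := by
    have : (0 : ℝ) ≤ ((n + 1 : ℕ) : ℝ) := Nat.cast_nonneg _
    nlinarith
  unfold daryRule
  rw [← Finset.sum_div, div_eq_one_iff_eq hpos.ne', Finset.sum_sub_distrib,
    Finset.sum_add_distrib, ← Finset.mul_sum, h1]
  simp only [sum_const, card_univ, nsmul_eq_mul, mul_one]
  linarith

lemma portRule_den_pos {α : ℝ} (hα : 0 < α) : 0 < (α + 1) * ((n + 1 : ℕ) : ℝ) - 1 := by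
  have : (1 : ℝ) ≤ ((n + 1 : ℕ) : ℝ) := by simp
  nlinarith

lemma sum_portRule {α : ℝ} (hα : 0 < α) (T : BucketTree b (n + 1)) :
    ∑ v : T.Bucket, portRule α (n + 1) (T.capacity v) (T.outdegree v) = 1 := by
  have h1 : (∑ v : T.Bucket, (T.capacity v : ℝ)) = ((n + 1 : ℕ) : ℝ) := by
    exact_mod_cast T.sum_capacity
  have h2 : (∑ v : T.Bucket, (T.outdegree v : ℝ)) + 1 = Fintype.card T.Bucket := by
    exact_mod_cast T.sum_outdegree
  unfold portRule
  rw [← Finset.sum_div, div_eq_one_iff_eq (portRule_den_pos hα).ne', Finset.sum_sub_distrib,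
    Finset.sum_add_distrib, ← Finset.mul_sum, h1]
  simp only [sum_const, card_univ, nsmul_eq_mul, mul_one]
  linarith

lemma sum_growthMass (hb : 1 ≤ b) (p : ℕ → ℕ → ℕ → ℝ)
    (hp : ∀ (n : ℕ) (T : BucketTree b (n + 1)),
      ∑ v : T.Bucket, p (n + 1) (T.capacity v) (T.outdegree v) = 1) (n : ℕ) :
    ∑ T : BucketTree b (n + 1), growthMass p n T = 1 := by
  classical
  induction n with
  | zero =>
    have : Fintype.card (BucketTree b (0 + 1)) = 1 := Fintype.card_eq_one_iff_nonempty_unique.2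
      (unique_one hb)
    simp [growthMass, this]
  | succ n ih =>
    simp only [growthMass]
    rw [Finset.sum_comm, ← ih]
    refine Finset.sum_congr rfl fun T _ => ?_
    rw [Finset.sum_comm]
    simp only [Finset.sum_ite_eq, mem_univ, if_true]
    rw [← Finset.mul_sum, hp n T, mul_one]

lemma growthMass_portRule_nonneg {α : ℝ} (hα : 0 < α) (n : ℕ) (T : BucketTree b (n + 1)) :
    0 ≤ growthMass (portRule α) n T := by
  induction n with
  | zero => simp [growthMass]
  | succ n ih =>
    simp only [growthMass]
    refine Finset.sum_nonneg fun S _ => Finset.sum_nonneg fun v _ => ?_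
    split_ifs
    · refine mul_nonneg (ih S) (div_nonneg ?_ (portRule_den_pos hα).le)
      have h1 : (1 : ℝ) ≤ S.capacity v := by exact_mod_cast S.one_le_capacity v
      have h2 : (0 : ℝ) ≤ S.outdegree v := Nat.cast_nonneg _
      nlinarith
    · exact le_rfl

lemma growthMass_daryRule_nonneg {d : ℕ} (hd : 2 ≤ d) (n : ℕ) (T : BucketTree b (n + 1)) :
    0 ≤ growthMass (daryRule d) n T ∧ (growthMass (daryRule d) n T ≠ 0 →
      ∀ v : T.Bucket, T.outdegree v ≤ (d - 1) * T.capacity v + 1) := by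
  obtain ⟨d, rfl⟩ : ∃ e, d = e + 1 := ⟨d - 1, by omega⟩
  have hrule : ∀ m c k : ℕ, daryRule (d + 1) m c k = ((d * c + 1 : ℕ) - (k : ℝ)) / (d * m + 1) := by
    intro m c k
    simp [daryRule]
  simp only [Nat.add_sub_cancel]
  induction n with
  | zero =>
    refine ⟨by simp [growthMass], fun _ v => ?_⟩
    have h := T.sum_outdegree
    have hc : Fintype.card T.Bucket ≤ 1 := by
      simpa using Fintype.card_subtype_le (fun v => T.head v = v)
    have : T.outdegree v ≤ ∑ v : T.Bucket, T.outdegree v :=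
      Finset.single_le_sum (f := fun v : T.Bucket => T.outdegree v)
        (fun _ _ => Nat.zero_le _) (mem_univ v)
    omega
  | succ n ih =>
    have hterm : ∀ (S : BucketTree b (n + 1)) (v : S.Bucket),
        0 ≤ growthMass (daryRule (d + 1)) n S *
          daryRule (d + 1) (n + 1) (S.capacity v) (S.outdegree v) := by
      intro S v
      by_cases h0 : growthMass (daryRule (d + 1)) n S = 0
      · simp [h0]
      · refine mul_nonneg (ih S).1 ?_
        rw [hrule]
        refine div_nonneg (sub_nonneg.2 ?_) (by positivity)
        exact_mod_cast (ih S).2 h0 v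
    refine ⟨?_, fun hne => ?_⟩
    · simp only [growthMass]
      refine Finset.sum_nonneg fun S _ => Finset.sum_nonneg fun v _ => ?_
      split_ifs
      · exact hterm S v
      · exact le_rfl
    · simp only [growthMass] at hne
      obtain ⟨S, -, hS⟩ := Finset.exists_ne_zero_of_sum_ne_zero hne
      obtain ⟨v, -, hv⟩ := Finset.exists_ne_zero_of_sum_ne_zero hS
      split_ifs at hv with hins
      · subst hins
        have hgood := (ih S).2 (left_ne_zero_of_mul hv)
        have hpv : S.outdegree v ≠ d * S.capacity v + 1 := by
          intro h
          apply right_ne_zero_of_mul hv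
          rw [hrule, h]
          simp
        rintro ⟨u, hu⟩
        revert hu
        refine Fin.lastCases ?_ (fun u => ?_) u
        · intro _
          simp [outdegree_insert_last]
        · intro hu
          have hu' : S.head u = u := by
            simpa [insert] using hu
          have h1 := hgood ⟨u, hu'⟩
          simp only [capacity_insert, outdegree_insert] at h1 ⊢
          by_cases hvu : v.1 = u
          · subst hvu
            have h2 := hgood v
            by_cases hc : S.capacity v < b
            · simp only [hc, not_true, false_and, and_self, if_true, if_false]
              nlinarith
            · simp only [hc, not_false_eq_true, and_self, false_and, if_true, if_false]
              simp only [add_zero]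
              omega
          · simpa [hvu] using h1
      · exact absurd rfl hv

lemma sum_ofReal_growthMass {p : ℕ → ℕ → ℕ → ℝ} {n : ℕ}
    (h0 : ∀ T : BucketTree b (n + 1), 0 ≤ growthMass p n T)
    (h1 : ∑ T : BucketTree b (n + 1), growthMass p n T = 1) :
    ∑ T : BucketTree b (n + 1), ENNReal.ofReal (growthMass p n T) = 1 := by
  rw [← ENNReal.ofReal_sum_of_nonneg fun T _ => h0 T, h1, ENNReal.ofReal_one]

/-- The law of the random `(b,d)`-ary increasing tree of size `n + 1`. -/
noncomputable def daryLaw (b d : ℕ) (hb : 1 ≤ b) (hd : 2 ≤ d) (n : ℕ) :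
    PMF (BucketTree b (n + 1)) :=
  PMF.ofFintype (fun T => ENNReal.ofReal (growthMass (daryRule d) n T))
    (sum_ofReal_growthMass (fun T => (growthMass_daryRule_nonneg hd n T).1)
      (sum_growthMass hb _ (fun _ T => sum_daryRule hd T) n))

/-- The law of the random `(b,α)`-plane oriented recursive tree of size `n + 1`. -/
noncomputable def portLaw (b : ℕ) (α : ℝ) (hb : 1 ≤ b) (hα : 0 < α) (n : ℕ) :
    PMF (BucketTree b (n + 1)) :=
  PMF.ofFintype (fun T => ENNReal.ofReal (growthMass (portRule α) n T))
    (sum_ofReal_growthMass (growthMass_portRule_nonneg hα n)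
      (sum_growthMass hb _ (fun _ T => sum_portRule hα T) n))

/-- The random variable `K`: the size of the bucket containing the largest label. -/
def lastBucketSize (T : BucketTree b (n + 1)) : ℕ := T.capacity (T.head (Fin.last n))

end BucketTree

/-- `H_{x+k} - H_x = ∑_{j=1}^{k} 1/(j+x)`. -/
noncomputable def harmonicDiff {F : Type*} [Field F] (x : F) (k : ℕ) : F :=
  ∑ j ∈ Finset.Icc 1 k, 1 / ((j : F) + x)

/-- The polynomial `λ^{\overline b} - (b+κ)^{\underline b}` in `λ`. -/
noncomputable def indicialPoly (b : ℕ) (κ : ℝ) : Polynomial ℂ :=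
  ascPochhammer ℂ b - Polynomial.C ((descPochhammer ℂ b).eval ((b : ℂ) + κ))

/-- The summand belonging to the root `l` in the formula for `P(K_n = m)`. -/
noncomputable def rootTerm (b : ℕ) (κ : ℝ) (n m : ℕ) (l : ℂ) : ℂ :=
  Ring.choose (l + n - 2) (n - 1) * Ring.choose (l + b - 1) (b - m) *
      Ring.choose ((m : ℂ) - 1 + κ) (m - 1) /
    (Ring.choose ((n : ℂ) - 1 + κ) (n - 1) * (Nat.choose b (m - 1) : ℂ) * ((b : ℂ) - m + 1) *
      Ring.choose ((b : ℂ) + κ) b * harmonicDiff (l - 1) b)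

/-- The mass at `m` of the limit law. -/
noncomputable def limitMass (b : ℕ) (κ : ℝ) (m : ℕ) : ℝ :=
  Ring.choose ((b : ℝ) + κ) (b - m) * Ring.choose ((m : ℝ) - 1 + κ) (m - 1) /
    ((Nat.choose b (m - 1) : ℝ) * ((b : ℝ) - m + 1) *
      Ring.choose ((b : ℝ) + κ) b * harmonicDiff κ b)

/-! Both growth models enter only through two facts: the attraction probabilities sum to one, and in
a tree of size `n + 1` a bucket of capacity `c` without children attracts the next label with
probability `(c + κ) / (n + 1 + κ)`. Unsaturated buckets have no children, so the probability that
the last bucket gets size `m + 1 ≥ 2` is a multiple of the expected number of buckets of capacity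
`m`. That number changes by `+1` when the new last bucket has size `m` and by `-1` when it has size
`m + 1`. Eliminating the expectations leaves the recurrence `IsLastBucketSequence`; size `1` is
recovered from the total mass.

For any `l`, the terms `∏ (l + j) / (κ + 1 + j) * bucketNumerator b κ l m` solve this recurrence in
`n` and `m` (`rootTerm_succ`). Their sum over `m` telescopes, and vanishes at every root of the
indicial polynomial other than `κ + 1` (`sub_mul_sum_bucketNumerator`); the root `κ + 1` contributes
total mass one. If the roots are distinct, weighting by the reciprocal derivatives matches the
initial law, since the weighted sum of a polynomial over the roots extracts its coefficient of
degree `b - 1` (`sum_bucketNumerator_div`).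

A multiple root `l` satisfies `∑ 1 / (l + j) = 0`, which forces `l` to be real and in `(-(b - 1),
0)`. There the rising factorial has absolute value at most `(b - 1)! / 4`, whereas the constant `∏
(κ + 1 + j)` is larger when `κ ≥ -1/2`. For general `κ > -1`, a multiple root makes this constant a
critical value of a fixed polynomial, and the constant is strictly increasing in `κ`; so there are
finitely many exceptions.

The limit must also cover multiple roots, so it does not use the explicit formula. Each sequence `n
↦ q n m` is annihilated by the indicial polynomial evaluated at the difference operator `eulerOp κ`.
The root `κ + 1` is simple and all others have smaller real part; removing the corresponding factors
one at a time gives `(κ + 1 + n) (q (n + 1) m - q n m) → 0`. The recurrence then makes `(κ + m) q n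
m` asymptotically independent of `m`, and normalisation determines the limit. -/

/-- The recurrence that characterises the distribution of the last bucket size: `q n m` is the
probability that the bucket containing the largest label of the tree of size `n + 1` has size `m`. -/
structure IsLastBucketSequence (b : ℕ) (κ : ℝ) (q : ℕ → ℕ → ℝ) : Prop where
  zero : ∀ m, q 0 m = if m = 1 then 1 else 0
  succ : ∀ n m : ℕ, 1 ≤ m → m < b →
    ((n : ℝ) + 1 + κ) * q (n + 1) (m + 1) = ((n : ℝ) - m) * q n (m + 1) + (m + κ) * q n m
  sum_eq_one : ∀ n, ∑ m ∈ Icc 1 b, q n m = 1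

/-! ### Bucket counts and the recurrence for the last bucket size. -/

namespace BucketTree

variable {b n : ℕ}

/-- The number of buckets of capacity `m`. -/
def bucketCount (T : BucketTree b n) (m : ℕ) : ℕ :=
  (univ.filter fun v => T.head v = v ∧ T.capacity v = m).card

lemma bucketCount_eq_sum (T : BucketTree b n) (m : ℕ) :
    (T.bucketCount m : ℝ) = ∑ v : T.Bucket, if T.capacity v = m then (1 : ℝ) else 0 := by
  rw [bucketCount, ← Finset.filter_filter, Finset.card_filter]
  push_cast
  exact Finset.sum_subtype (p := fun v => T.head v = v) _ (by simp)
    (fun v => if T.capacity v = m then (1 : ℝ) else 0)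

lemma capacity_insert_last (T : BucketTree b n) (v : T.Bucket) :
    (T.insert v).capacity (Fin.last n) = if T.capacity v < b then 0 else 1 := by
  have hins : (T.insert v).head = Fin.snoc (α := fun _ => Fin (n + 1))
    (fun i => (T.head i).castSucc)
    (if T.capacity v < b then v.1.castSucc else Fin.last n) := rfl
  rw [capacity, hins, Finset.card_filter, Fin.sum_univ_castSucc]
  simp only [Fin.snoc_castSucc, Fin.snoc_last]
  by_cases h : T.capacity v < b <;> simp [h, Fin.castSucc_ne_last]

lemma head_insert_last (T : BucketTree b n) (v : T.Bucket) :
    (T.insert v).head (Fin.last n) =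
      if T.capacity v < b then v.1.castSucc else Fin.last n := by
  simp [insert]

lemma head_insert_castSucc (T : BucketTree b n) (v : T.Bucket) (i : Fin n) :
    (T.insert v).head i.castSucc = (T.head i).castSucc := by
  simp [insert]

lemma lastBucketSize_insert (T : BucketTree b (n + 1)) (v : T.Bucket) :
    (T.insert v).lastBucketSize = if T.capacity v < b then T.capacity v + 1 else 1 := by
  rw [lastBucketSize, head_insert_last]
  by_cases h : T.capacity v < b
  · simp [h, capacity_insert]
  · simp [h, capacity_insert_last]

lemma lastBucketSize_mem_Icc (T : BucketTree b (n + 1)) : T.lastBucketSize ∈ Icc 1 b :=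
  Finset.mem_Icc.2 ⟨T.one_le_capacity ⟨_, T.head_head _⟩, T.card_le _⟩

/-- A bucket that grows from `c` to `c + 1` leaves the class `c` and enters the class `c + 1`; a new
bucket only enters the class `1`. The case `m = 0` must be excluded: a new bucket of size `1` was
not a bucket of size `0` before. -/
lemma bucketCount_insert (T : BucketTree b (n + 1)) (v : T.Bucket) {m : ℕ} (hm : 1 ≤ m) :
    ((T.insert v).bucketCount m : ℝ) = T.bucketCount m +
      (if (T.insert v).lastBucketSize = m then 1 else 0) -
      (if (T.insert v).lastBucketSize = m + 1 then 1 else 0) := by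
  have hv : T.head v.1 = v.1 := v.2
  rw [lastBucketSize_insert, bucketCount, bucketCount, Finset.card_filter, Finset.card_filter,
    Fin.sum_univ_castSucc]
  simp only [head_insert_castSucc, Fin.castSucc_inj, capacity_insert, head_insert_last,
    capacity_insert_last]
  by_cases h : T.capacity v < b
  · simp only [h, if_true, true_and, Fin.castSucc_ne_last, false_and, if_false, add_zero]
    rw [← Finset.add_sum_erase _ _ (mem_univ v.1),
      ← Finset.add_sum_erase _ (fun i => if T.head i = i ∧ T.capacity i = m then 1 else 0)
        (mem_univ v.1)]
    have : ∀ i ∈ univ.erase v.1,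
        (if T.head i = i ∧ T.capacity i + (if v.1 = i then 1 else 0) = m then 1 else 0) =
        (if T.head i = i ∧ T.capacity i = m then 1 else 0) := by
      intro i hi
      have : v.1 ≠ i := fun h => (Finset.ne_of_mem_erase hi) h.symm
      simp [this]
    rw [Finset.sum_congr rfl this]
    by_cases h2 : T.capacity v = m
    · simp [hv, h2]
    · by_cases h3 : T.capacity v + 1 = m
      · simp [hv, h2, h3]; ring
      · simp [hv, h2, h3]
  · have h2 : 1 ≠ m + 1 := by omega
    simp only [h, if_false, false_and, add_zero, true_and, h2]
    by_cases h3 : 1 = m <;> simp [h3]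

/-- Expectation of a function of the random tree of size `n + 1` grown by the rule `p`. -/
noncomputable def growthExp (p : ℕ → ℕ → ℕ → ℝ) (n : ℕ) (f : BucketTree b (n + 1) → ℝ) : ℝ :=
  ∑ T : BucketTree b (n + 1), growthMass p n T * f T

lemma growthExp_succ (p : ℕ → ℕ → ℕ → ℝ) (n : ℕ) (f : BucketTree b (n + 1 + 1) → ℝ) :
    growthExp p (n + 1) f = growthExp p n fun T =>
      ∑ v : T.Bucket, p (n + 1) (T.capacity v) (T.outdegree v) * f (T.insert v) := by
  classical
  simp only [growthExp, growthMass, Finset.sum_mul]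
  rw [Finset.sum_comm]
  refine Finset.sum_congr rfl fun T _ => ?_
  rw [Finset.sum_comm, Finset.mul_sum]
  refine Finset.sum_congr rfl fun v _ => ?_
  simp only [ite_mul, zero_mul, Finset.sum_ite_eq, mem_univ, if_true, mul_assoc]

/-- The probability that the bucket containing the largest label of the random tree of size
`n + 1` has size `m`. -/
noncomputable def lastBucketProb (b : ℕ) (p : ℕ → ℕ → ℕ → ℝ) (n m : ℕ) : ℝ :=
  growthExp p n fun T : BucketTree b (n + 1) => if T.lastBucketSize = m then 1 else 0

lemma growthExp_zero (hb : 1 ≤ b) (p : ℕ → ℕ → ℕ → ℝ) {f : BucketTree b (0 + 1) → ℝ} {c : ℝ}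
    (hf : ∀ T, f T = c) : growthExp p 0 f = c := by
  have : Fintype.card (BucketTree b (0 + 1)) = 1 := Fintype.card_eq_one_iff_nonempty_unique.2
    (unique_one hb)
  simp [growthExp, growthMass, hf, this]

lemma capacity_of_size_one (T : BucketTree b (0 + 1)) (i : Fin (0 + 1)) : T.capacity i = 1 := by
  have h : ∀ j, T.head j = i := fun j => Subsingleton.elim (α := Fin 1) _ _
  simp [capacity, h]

/-- Size `m + 1 ≥ 2` arises exactly when a bucket of capacity `m < b` attracts the label. Such a
bucket has out-degree zero, so all of them have the same probability and only their number matters.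
-/
lemma lastBucketProb_succ {κ : ℝ} (hκ : -1 < κ) {p : ℕ → ℕ → ℕ → ℝ}
    (hp0 : ∀ n c, p (n + 1) c 0 = (c + κ) / (n + 1 + κ)) (n : ℕ) {m : ℕ} (hm : 1 ≤ m)
    (hmb : m < b) :
    ((n : ℝ) + 1 + κ) * lastBucketProb b p (n + 1) (m + 1) =
      (m + κ) * growthExp p n fun T : BucketTree b (n + 1) => (T.bucketCount m : ℝ) := by
  have hpos : 0 < (n : ℝ) + 1 + κ := by have := n.cast_nonneg (α := ℝ); linarith
  rw [lastBucketProb, growthExp_succ, growthExp, growthExp, Finset.mul_sum, Finset.mul_sum]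
  refine Finset.sum_congr rfl fun T _ => ?_
  rw [bucketCount_eq_sum, Finset.mul_sum, Finset.mul_sum, Finset.mul_sum, Finset.mul_sum]
  refine Finset.sum_congr rfl fun v _ => ?_
  rw [lastBucketSize_insert]
  by_cases h : T.capacity v < b
  · simp only [h, if_true, T.outdegree_eq_zero v h, hp0, Nat.add_right_cancel_iff]
    by_cases h2 : T.capacity v = m
    · simp only [h2, if_true]
      field_simp
    · simp [h2]
  · have h2 : 1 ≠ m + 1 := by omega
    have h3 : T.capacity v ≠ m := by omega
    simp only [h, if_false, h2, h3, mul_zero]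

lemma growthExp_bucketCount_succ {p : ℕ → ℕ → ℕ → ℝ}
    (hp : ∀ (n : ℕ) (T : BucketTree b (n + 1)),
      ∑ v : T.Bucket, p (n + 1) (T.capacity v) (T.outdegree v) = 1) (n : ℕ) {m : ℕ}
    (hm : 1 ≤ m) :
    (growthExp p (n + 1) fun T : BucketTree b (n + 1 + 1) => (T.bucketCount m : ℝ)) =
      (growthExp p n fun T : BucketTree b (n + 1) => (T.bucketCount m : ℝ)) +
        lastBucketProb b p (n + 1) m - lastBucketProb b p (n + 1) (m + 1) := by
  rw [lastBucketProb, lastBucketProb, growthExp_succ, growthExp_succ, growthExp_succ]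
  simp only [growthExp]
  rw [← Finset.sum_add_distrib, ← Finset.sum_sub_distrib]
  refine Finset.sum_congr rfl fun T _ => ?_
  rw [← mul_add, ← mul_sub]
  congr 1
  have h : (T.bucketCount m : ℝ) = ∑ v : T.Bucket,
      p (n + 1) (T.capacity v) (T.outdegree v) * T.bucketCount m := by
    rw [← Finset.sum_mul, hp n T, one_mul]
  conv_rhs => rw [h]
  rw [← Finset.sum_add_distrib, ← Finset.sum_sub_distrib]
  refine Finset.sum_congr rfl fun v _ => ?_
  rw [bucketCount_insert T v hm]
  ring

theorem isLastBucketSequence_lastBucketProb (hb : 1 ≤ b) {κ : ℝ} (hκ : -1 < κ)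
    {p : ℕ → ℕ → ℕ → ℝ} (hp0 : ∀ n c, p (n + 1) c 0 = (c + κ) / (n + 1 + κ))
    (hp : ∀ (n : ℕ) (T : BucketTree b (n + 1)),
      ∑ v : T.Bucket, p (n + 1) (T.capacity v) (T.outdegree v) = 1) :
    IsLastBucketSequence b κ (lastBucketProb b p) where
  zero m := by
    refine growthExp_zero hb p fun T => ?_
    simp [lastBucketSize, capacity_of_size_one, eq_comm]
  sum_eq_one n := by
    simp only [lastBucketProb, growthExp]
    rw [Finset.sum_comm]
    refine (Finset.sum_congr rfl fun T _ => ?_).trans (sum_growthMass hb p hp n)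
    rw [← Finset.mul_sum, Finset.sum_ite_eq, if_pos T.lastBucketSize_mem_Icc, mul_one]
  succ n m hm hmb := by
    rw [lastBucketProb_succ hκ hp0 n hm hmb]
    cases n with
    -- A tree of size one has no predecessor from which to eliminate the count, so the first step is
    -- checked directly.
    | zero =>
      have h1 : (growthExp p 0 fun T : BucketTree b (0 + 1) => (T.bucketCount m : ℝ)) =
          if 1 = m then 1 else 0 := by
        refine growthExp_zero hb p fun T => ?_
        have h : ∀ j, T.head j = j := fun j => Subsingleton.elim (α := Fin 1) _ _
        by_cases h1 : 1 = m <;> simp [bucketCount, capacity_of_size_one, h, h1]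
      have h2 : ∀ k, lastBucketProb b p 0 k = if 1 = k then 1 else 0 := by
        intro k
        refine growthExp_zero hb p fun T => ?_
        simp [lastBucketSize, capacity_of_size_one]
      rw [h1, h2, h2]
      simp
    | succ n =>
      rw [growthExp_bucketCount_succ hp n hm]
      have := lastBucketProb_succ (b := b) hκ hp0 n hm hmb
      push_cast
      linarith

lemma real_ofFintype_lastBucketSize {p : ℕ → ℕ → ℕ → ℝ} {n : ℕ}
    (h0 : ∀ T : BucketTree b (n + 1), 0 ≤ growthMass p n T)
    (h1 : ∑ T : BucketTree b (n + 1), ENNReal.ofReal (growthMass p n T) = 1) (m : ℕ) :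
    (PMF.ofFintype (fun T => ENNReal.ofReal (growthMass p n T)) h1).toMeasure.real
      {T | T.lastBucketSize = m} = lastBucketProb b p n m := by
  rw [measureReal_def, PMF.toMeasure_ofFintype_apply (hs := MeasurableSpace.measurableSet_top),
    tsum_fintype, ENNReal.toReal_sum, lastBucketProb, growthExp]
  · refine Finset.sum_congr rfl fun T _ => ?_
    by_cases h : T.lastBucketSize = m <;> simp [h, h0]
  · intro T _
    by_cases h : T.lastBucketSize = m <;> simp [h]

end BucketTree

/-! ### Rising factorials and the reduction of the binomial expressions. -/

section Pochhammer

variable {K : Type*} [Field K]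

lemma ascPochhammer_eval_eq_prod_range (x : K) (n : ℕ) :
    (ascPochhammer K n).eval x = ∏ j ∈ range n, (x + j) := by
  induction n with
  | zero => simp
  | succ n ih => rw [ascPochhammer_succ_eval, ih, prod_range_succ]

lemma ring_choose_add_sub_one [CharZero K] (x : K) (k : ℕ) :
    Ring.choose (x + k - 1) k = (∏ j ∈ range k, (x + j)) / (k.factorial : K) := by
  rw [← Ring.multichoose_eq, eq_div_iff (by exact_mod_cast k.factorial_ne_zero),
    ← ascPochhammer_eval_eq_prod_range, ← Polynomial.ascPochhammer_smeval_eq_eval,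
    ← Ring.factorial_nsmul_multichoose_eq_ascPochhammer, nsmul_eq_mul, mul_comm]

lemma ring_choose_natCast_add [CharZero K] (x : K) (k : ℕ) :
    Ring.choose ((k : K) + x) k = (∏ j ∈ range k, (x + 1 + j)) / (k.factorial : K) := by
  rw [← ring_choose_add_sub_one]
  congr 1
  ring

lemma harmonicDiff_eq_sum_range (x : K) (k : ℕ) :
    harmonicDiff x k = ∑ j ∈ range k, 1 / (x + 1 + j) := by
  rw [harmonicDiff]
  induction k with
  | zero => simp
  | succ k ih =>
    rw [sum_Icc_succ_top (by omega), ih, sum_range_succ]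
    congr 2
    push_cast
    ring

/-- The polynomial `(κ+1)⋯(κ+m) (x+m+1)⋯(x+b-1)`, a multiple of the numerator of the probability
of bucket size `m + 1`. -/
def bucketNumerator (b : ℕ) (κ x : K) (m : ℕ) : K :=
  (∏ j ∈ range m, (κ + 1 + j)) * ∏ j ∈ Ico (m + 1) b, (x + j)

lemma bucketNumerator_succ {b m : ℕ} (h : m + 1 < b) (κ x : K) :
    (x + (m + 1 : ℕ)) * bucketNumerator b κ x (m + 1) =
      (κ + 1 + m) * bucketNumerator b κ x m := by
  rw [bucketNumerator, bucketNumerator, prod_eq_prod_Ico_succ_bot h, prod_range_succ]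
  ring

/-- The factor `x - (κ + 1) = (x + m) - (κ + 1 + m)` turns the `m`-th summand into a difference of
consecutive mixed products, in which the first `m` factors use `κ + 1` and the others use `x`. -/
lemma sub_mul_sum_bucketNumerator (b : ℕ) (κ x : K) :
    (x - (κ + 1)) * ∑ m ∈ range b, bucketNumerator b κ x m =
      ∏ j ∈ range b, (x + j) - ∏ j ∈ range b, (κ + 1 + j) := by
  have h := sum_range_sub' (fun m => (∏ j ∈ range m, (κ + 1 + j)) * ∏ j ∈ Ico m b, (x + (j : K))) b
  simp only [range_zero, prod_empty, one_mul, Ico_self, mul_one, ← range_eq_Ico] at h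
  rw [← h, mul_sum]
  refine sum_congr rfl fun m hm => ?_
  rw [bucketNumerator, prod_eq_prod_Ico_succ_bot (mem_range.1 hm), prod_range_succ]
  ring

lemma mul_bucketNumerator_self {b m : ℕ} (h : m < b) (κ : K) :
    (κ + 1 + m) * bucketNumerator b κ (κ + 1) m = ∏ j ∈ range b, (κ + 1 + (j : K)) := by
  rw [bucketNumerator, ← prod_range_mul_prod_Ico _ h.le, prod_eq_prod_Ico_succ_bot h]
  ring

lemma ring_choose_add_sub_one_sub [CharZero K] {b m : ℕ} (h : m < b) (x : K) :
    Ring.choose (x + b - 1) (b - (m + 1)) =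
      (∏ j ∈ Ico (m + 1) b, (x + j)) / ((b - (m + 1)).factorial : K) := by
  rw [prod_Ico_eq_prod_range]
  have h1 := ring_choose_add_sub_one (x + (m + 1 : ℕ)) (b - (m + 1))
  have h2 : x + (m + 1 : ℕ) + ((b - (m + 1) : ℕ) : K) - 1 = x + b - 1 := by
    rw [Nat.cast_sub (by omega)]
    ring
  rw [h2] at h1
  rw [h1]
  congr 1
  refine prod_congr rfl fun j _ => ?_
  push_cast
  ring

lemma natCast_choose_mul_sub {b m : ℕ} (h : m < b) :
    (Nat.choose b m : K) * ((b : K) - ((m + 1 : ℕ) : K) + 1) *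
      ((m.factorial : K) * ((b - (m + 1)).factorial : K)) = (b.factorial : K) := by
  obtain ⟨k, rfl⟩ : ∃ k, b = m + 1 + k := ⟨b - (m + 1), by omega⟩
  have h1 := Nat.choose_mul_factorial_mul_factorial (n := m + 1 + k) (k := m) (by omega)
  have h2 : m + 1 + k - m = k + 1 := by omega
  have h3 : m + 1 + k - (m + 1) = k := by omega
  rw [h2, Nat.factorial_succ] at h1
  rw [h3, ← h1]
  push_cast
  ring

lemma choose_mul_choose_div [CharZero K] {b m : ℕ} (h : m < b) (κ x c d : K) :
    c * Ring.choose (x + b - 1) (b - (m + 1)) * Ring.choose (((m + 1 : ℕ) : K) - 1 + κ) m /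
      (d * (Nat.choose b m : K) * ((b : K) - ((m + 1 : ℕ) : K) + 1) *
        Ring.choose ((b : K) + κ) b * harmonicDiff (x - 1) b) =
    c / d * bucketNumerator b κ x m /
      ((∏ j ∈ range b, (κ + 1 + j)) * harmonicDiff (x - 1) b) := by
  have e1 : ((m + 1 : ℕ) : K) - 1 + κ = m + κ := by push_cast; ring
  have hb : (b.factorial : K) ≠ 0 := by exact_mod_cast b.factorial_ne_zero
  have h1 : (m.factorial : K) ≠ 0 := by exact_mod_cast m.factorial_ne_zero
  have h2 : ((b - (m + 1)).factorial : K) ≠ 0 := by exact_mod_cast (b - (m + 1)).factorial_ne_zero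
  have h3 := natCast_choose_mul_sub (K := K) h
  rw [e1, ring_choose_add_sub_one_sub h, ring_choose_natCast_add, ring_choose_natCast_add,
    bucketNumerator]
  have h4 : (Nat.choose b m : K) * ((b : K) - ((m + 1 : ℕ) : K) + 1) =
      (b.factorial : K) / ((m.factorial : K) * ((b - (m + 1)).factorial : K)) := by
    rw [eq_div_iff (mul_ne_zero h1 h2), h3]
  rw [mul_assoc d, h4]
  generalize (∏ j ∈ range b, (κ + 1 + (j : K))) = P
  generalize harmonicDiff (x - 1) b = H
  -- Where a denominator vanishes, both sides are zero by the convention for division; hence no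
  -- nonvanishing hypotheses are needed.
  by_cases hd : d = 0
  · simp [hd]
  by_cases hP : P = 0
  · simp [hP]
  by_cases hH : H = 0
  · simp [hH]
  field_simp

end Pochhammer

/-! ### The indicial polynomial and the sum over its roots. -/

lemma rootTerm_eq (b : ℕ) (κ : ℝ) (n : ℕ) {m : ℕ} (h : m < b) (l : ℂ) :
    rootTerm b κ (n + 1) (m + 1) l =
      (∏ j ∈ range n, (l + j)) / (∏ j ∈ range n, ((κ : ℂ) + 1 + j)) *
        bucketNumerator b (κ : ℂ) l m /
      ((∏ j ∈ range b, ((κ : ℂ) + 1 + j)) * harmonicDiff (l - 1) b) := by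
  have e1 : l + ((n + 1 : ℕ) : ℂ) - 2 = l + n - 1 := by push_cast; ring
  have e2 : ((n + 1 : ℕ) : ℂ) - 1 + κ = n + κ := by push_cast; ring
  have hn : (n.factorial : ℂ) ≠ 0 := by exact_mod_cast n.factorial_ne_zero
  rw [rootTerm]
  simp only [Nat.add_sub_cancel]
  rw [choose_mul_choose_div h, e1, e2, ring_choose_add_sub_one, ring_choose_natCast_add,
    div_div_div_cancel_right₀ hn]

lemma limitMass_eq {b : ℕ} {κ : ℝ} (hκ : -1 < κ) {m : ℕ} (h : m < b) :
    limitMass b κ (m + 1) = 1 / ((κ + 1 + m) * harmonicDiff κ b) := by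
  have hp : 0 < ∏ j ∈ range b, (κ + 1 + (j : ℝ)) := prod_pos fun j _ => by
    have := j.cast_nonneg (α := ℝ); linarith
  have h1 := choose_mul_choose_div h κ (κ + 1) 1 1
  have h2 : κ + 1 + (b : ℝ) - 1 = b + κ := by ring
  rw [h2] at h1
  simp only [one_mul, div_one, add_sub_cancel_right] at h1
  have hm : 0 < κ + 1 + (m : ℝ) := by have := m.cast_nonneg (α := ℝ); linarith
  rw [limitMass, Nat.add_sub_cancel, h1, ← mul_bucketNumerator_self h] at *
  have : bucketNumerator b κ (κ + 1) m ≠ 0 := right_ne_zero_of_mul hp.ne'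
  field_simp

lemma ascPochhammer_eq_prod_X_add_C (R : Type*) [CommRing R] (n : ℕ) :
    ascPochhammer R n = ∏ j ∈ range n, (Polynomial.X + Polynomial.C (j : R)) := by
  induction n with
  | zero => simp
  | succ n ih => rw [ascPochhammer_succ_right, ih, prod_range_succ]; simp

lemma derivative_ascPochhammer_eval {K : Type*} [Field K] (n : ℕ) {x : K}
    (h : ∀ j ∈ range n, x + j ≠ 0) :
    (Polynomial.derivative (ascPochhammer K n)).eval x =
      (∏ j ∈ range n, (x + j)) * harmonicDiff (x - 1) n := by
  induction n with
  | zero => simp [harmonicDiff]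
  | succ n ih =>
    have hn : x + n ≠ 0 := h n (by simp)
    rw [ascPochhammer_succ_right, Polynomial.derivative_mul, Polynomial.eval_add,
      Polynomial.eval_mul, Polynomial.eval_mul, ih fun j hj => h j (by simp at hj ⊢; omega),
      ascPochhammer_eval_eq_prod_range, prod_range_succ, harmonicDiff_eq_sum_range,
      harmonicDiff_eq_sum_range, sum_range_succ]
    simp only [Polynomial.derivative_add, Polynomial.derivative_X, Polynomial.derivative_natCast,
      Polynomial.eval_add, Polynomial.eval_X, Polynomial.eval_natCast, Polynomial.eval_one,
      add_zero, sub_add_cancel, mul_one]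
    field_simp

lemma indicialPoly_eq (b : ℕ) (κ : ℝ) :
    indicialPoly b κ =
      ascPochhammer ℂ b - Polynomial.C (∏ j ∈ range b, ((κ : ℂ) + 1 + j)) := by
  rw [indicialPoly, descPochhammer_eval_eq_prod_range]
  congr 2
  rw [← prod_range_reflect]
  refine prod_congr rfl fun j hj => ?_
  have := mem_range.1 hj
  rw [Nat.cast_sub (by omega), Nat.cast_sub (by omega)]
  push_cast
  ring

lemma indicialPoly_eval (b : ℕ) (κ : ℝ) (x : ℂ) :
    (indicialPoly b κ).eval x =
      ∏ j ∈ range b, (x + j) - ∏ j ∈ range b, ((κ : ℂ) + 1 + j) := by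
  rw [indicialPoly_eq, Polynomial.eval_sub, Polynomial.eval_C, ascPochhammer_eval_eq_prod_range]

lemma indicialPoly_monic {b : ℕ} (hb : 1 ≤ b) (κ : ℝ) : (indicialPoly b κ).Monic := by
  rw [indicialPoly]
  refine (monic_ascPochhammer ℂ b).sub_of_left ?_
  refine Polynomial.degree_C_le.trans_lt ?_
  rw [Polynomial.degree_eq_natDegree (monic_ascPochhammer ℂ b).ne_zero, ascPochhammer_natDegree]
  exact_mod_cast hb

lemma indicialPoly_natDegree (b : ℕ) (κ : ℝ) : (indicialPoly b κ).natDegree = b := by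
  rw [indicialPoly, Polynomial.natDegree_sub_C, ascPochhammer_natDegree]

lemma indicialPoly_derivative (b : ℕ) (κ : ℝ) :
    Polynomial.derivative (indicialPoly b κ) = Polynomial.derivative (ascPochhammer ℂ b) := by
  simp [indicialPoly]

lemma card_roots_indicialPoly (b : ℕ) (κ : ℝ) :
    Multiset.card (indicialPoly b κ).roots = b := by
  rw [← (IsAlgClosed.splits (indicialPoly b κ)).natDegree_eq_card_roots, indicialPoly_natDegree]

lemma indicialPoly_eq_prod_roots {b : ℕ} (hb : 1 ≤ b) (κ : ℝ) :
    indicialPoly b κ = ((indicialPoly b κ).roots.map fun l => Polynomial.X - Polynomial.C l).prod :=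
  (IsAlgClosed.splits (indicialPoly b κ)).eq_prod_roots_of_monic (indicialPoly_monic hb κ)

lemma mem_roots_indicialPoly {b : ℕ} (hb : 1 ≤ b) (κ : ℝ) {l : ℂ} :
    l ∈ (indicialPoly b κ).roots ↔
      ∏ j ∈ range b, (l + j) = ∏ j ∈ range b, ((κ : ℂ) + 1 + j) := by
  rw [Polynomial.mem_roots (indicialPoly_monic hb κ).ne_zero, Polynomial.IsRoot,
    indicialPoly_eval, sub_eq_zero]

section
variable {κ : ℝ}

lemma add_one_add_natCast_pos (hκ : -1 < κ) (j : ℕ) : 0 < κ + 1 + (j : ℝ) := by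
  have := j.cast_nonneg (α := ℝ); linarith

lemma complex_add_one_add_natCast_ne_zero (hκ : -1 < κ) (j : ℕ) : (κ : ℂ) + 1 + j ≠ 0 := by
  exact_mod_cast (add_one_add_natCast_pos hκ j).ne'

lemma prod_add_one_add_ne_zero (hκ : -1 < κ) (n : ℕ) :
    ∏ j ∈ range n, ((κ : ℂ) + 1 + j) ≠ 0 :=
  prod_ne_zero_iff.2 fun j _ => complex_add_one_add_natCast_ne_zero hκ j

lemma harmonicDiff_pos (hκ : -1 < κ) {b : ℕ} (hb : 1 ≤ b) : 0 < harmonicDiff κ b := by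
  rw [harmonicDiff_eq_sum_range]
  exact sum_pos (fun j _ => one_div_pos.2 (add_one_add_natCast_pos hκ j)) ⟨0, by simp; omega⟩

lemma ofReal_harmonicDiff (κ : ℝ) (b : ℕ) :
    ((harmonicDiff κ b : ℝ) : ℂ) = harmonicDiff (κ : ℂ) b := by
  simp [harmonicDiff]

lemma add_natCast_ne_zero_of_mem_roots (hκ : -1 < κ) {b : ℕ} (hb : 1 ≤ b) {l : ℂ}
    (hl : l ∈ (indicialPoly b κ).roots) : ∀ j ∈ range b, l + j ≠ 0 := by
  rw [mem_roots_indicialPoly hb] at hl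
  exact prod_ne_zero_iff.1 (hl ▸ prod_add_one_add_ne_zero hκ b)

/-- This identifies the denominator of `rootTerm_eq`, apart from its dependence on `n`, as the
derivative at the root. -/
lemma derivative_indicialPoly_eval_of_mem_roots (hκ : -1 < κ) {b : ℕ} (hb : 1 ≤ b) {l : ℂ}
    (hl : l ∈ (indicialPoly b κ).roots) :
    (Polynomial.derivative (indicialPoly b κ)).eval l =
      (∏ j ∈ range b, ((κ : ℂ) + 1 + j)) * harmonicDiff (l - 1) b := by
  rw [indicialPoly_derivative, derivative_ascPochhammer_eval b
    (add_natCast_ne_zero_of_mem_roots hκ hb hl), (mem_roots_indicialPoly hb κ).1 hl]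

lemma add_one_mem_roots {b : ℕ} (hb : 1 ≤ b) : (κ : ℂ) + 1 ∈ (indicialPoly b κ).roots :=
  (mem_roots_indicialPoly hb κ).2 rfl

lemma eval_derivative_indicialPoly_eq_prod {b : ℕ} (hb : 1 ≤ b)
    (hnd : (indicialPoly b κ).roots.Nodup) {l : ℂ} (hl : l ∈ (indicialPoly b κ).roots.toFinset) :
    (Polynomial.derivative (indicialPoly b κ)).eval l =
      ∏ j ∈ (indicialPoly b κ).roots.toFinset.erase l, (l - j) := by
  have h : indicialPoly b κ = Lagrange.nodal (indicialPoly b κ).roots.toFinset id := by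
    conv_lhs => rw [indicialPoly_eq_prod_roots hb κ]
    rw [Lagrange.nodal_eq, prod_multiset_map_count]
    refine prod_congr rfl fun l hl => ?_
    rw [Multiset.count_eq_one_of_mem hnd (Multiset.mem_toFinset.1 hl), pow_one]
    rfl
  conv_lhs => rw [h]
  have := Lagrange.eval_nodal_derivative_eval_node_eq (v := (id : ℂ → ℂ)) hl
  rw [id] at this
  rw [this, Lagrange.eval_nodal]
  rfl

/-- `bucketNumerator` as a polynomial in its last argument. -/
noncomputable def bucketPoly (b : ℕ) (κ : ℂ) (m : ℕ) : Polynomial ℂ :=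
  Polynomial.C (∏ j ∈ range m, (κ + 1 + j)) *
    ∏ j ∈ Ico (m + 1) b, (Polynomial.X + Polynomial.C (j : ℂ))

lemma bucketPoly_eval (b : ℕ) (κ l : ℂ) (m : ℕ) :
    (bucketPoly b κ m).eval l = bucketNumerator b κ l m := by
  simp [bucketPoly, bucketNumerator, Polynomial.eval_prod]

lemma natDegree_bucketPoly_le (b : ℕ) (κ : ℂ) (m : ℕ) :
    (bucketPoly b κ m).natDegree ≤ b - (m + 1) := by
  refine (Polynomial.natDegree_C_mul_le _ _).trans ?_
  rw [Polynomial.natDegree_prod_of_monic _ _ fun j _ => Polynomial.monic_X_add_C _]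
  simp [-map_natCast]

lemma coeff_bucketPoly {b m : ℕ} (h : m < b) (κ : ℂ) :
    (bucketPoly b κ m).coeff (b - 1) = if m = 0 then 1 else 0 := by
  split_ifs with hm
  · subst hm
    have hmon : (∏ j ∈ Ico (0 + 1) b, (Polynomial.X + Polynomial.C (j : ℂ))).Monic :=
      Polynomial.monic_prod_of_monic _ _ fun j _ => Polynomial.monic_X_add_C _
    have hdeg : (∏ j ∈ Ico (0 + 1) b, (Polynomial.X + Polynomial.C (j : ℂ))).natDegree = b - 1 := by
      rw [Polynomial.natDegree_prod_of_monic _ _ fun j _ => Polynomial.monic_X_add_C _]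
      simp [-map_natCast]
    rw [bucketPoly, range_zero, prod_empty, Polynomial.C_1, one_mul, ← hdeg]
    exact hmon.coeff_natDegree
  · exact Polynomial.coeff_eq_zero_of_natDegree_lt
      ((natDegree_bucketPoly_le b κ m).trans_lt (by omega))

/-- By Lagrange interpolation at the `b` distinct roots, the left side is the coefficient of degree
`b - 1` of `bucketPoly`, which is monic of that degree for `m = 0` and of smaller degree otherwise.
-/
lemma sum_bucketNumerator_div {b : ℕ} (hκ : -1 < κ) (hnd : (indicialPoly b κ).roots.Nodup)
    {m : ℕ} (h : m < b) :
    ∑ l ∈ (indicialPoly b κ).roots.toFinset, bucketNumerator b (κ : ℂ) l m /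
      ((∏ j ∈ range b, ((κ : ℂ) + 1 + j)) * harmonicDiff (l - 1) b) =
      if m = 0 then 1 else 0 := by
  have hb : 1 ≤ b := by omega
  have hcard : #(indicialPoly b κ).roots.toFinset = b := by
    rw [Multiset.toFinset_card_of_nodup hnd, card_roots_indicialPoly]
  have hdeg : (bucketPoly b κ m).degree < #(indicialPoly b κ).roots.toFinset := by
    rw [hcard]
    refine Polynomial.degree_le_natDegree.trans_lt ?_
    exact_mod_cast (natDegree_bucketPoly_le b κ m).trans_lt (by omega)
  have := Lagrange.coeff_eq_sum (v := (id : ℂ → ℂ)) Function.injective_id.injOn hdeg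
  rw [hcard, coeff_bucketPoly h] at this
  rw [this]
  refine sum_congr rfl fun l hl => ?_
  simp only [id, bucketPoly_eval]
  rw [← eval_derivative_indicialPoly_eq_prod hb hnd hl,
    derivative_indicialPoly_eval_of_mem_roots hκ hb (Multiset.mem_toFinset.1 hl)]

lemma sum_range_rootTerm_eq_zero {b : ℕ} (hb : 1 ≤ b) (n : ℕ) {l : ℂ}
    (hl : l ∈ (indicialPoly b κ).roots) (hne : l ≠ κ + 1) :
    ∑ m ∈ range b, rootTerm b κ (n + 1) (m + 1) l = 0 := by
  rw [sum_congr rfl fun m hm => rootTerm_eq b κ n (mem_range.1 hm) l, ← sum_div, ← mul_sum]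
  have h := sub_mul_sum_bucketNumerator b (κ : ℂ) l
  rw [(mem_roots_indicialPoly hb κ).1 hl, sub_self] at h
  rw [(mul_eq_zero.1 h).resolve_left (sub_ne_zero.2 hne)]
  simp

/-- The two products depending on `n` cancel at the root `κ + 1`, so its contribution is constant in
`n`; it is already the limit law. -/
lemma rootTerm_add_one (hκ : -1 < κ) {b m : ℕ} (h : m < b) (n : ℕ) :
    rootTerm b κ (n + 1) (m + 1) (κ + 1) =
      1 / (((κ : ℂ) + 1 + m) * harmonicDiff (κ : ℂ) b) := by
  have h1 := mul_bucketNumerator_self h (κ : ℂ)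
  have h2 := prod_add_one_add_ne_zero hκ b
  rw [rootTerm_eq b κ n h, div_self (prod_add_one_add_ne_zero hκ n), ← h1, add_sub_cancel_right]
  rw [← h1] at h2
  have h3 := right_ne_zero_of_mul h2
  have h4 := left_ne_zero_of_mul h2
  field_simp

lemma sum_rootTerm_add_one (hκ : -1 < κ) {b : ℕ} (hb : 1 ≤ b) (n : ℕ) :
    ∑ m ∈ range b, rootTerm b κ (n + 1) (m + 1) (κ + 1) = 1 := by
  rw [sum_congr rfl fun m hm => rootTerm_add_one hκ (mem_range.1 hm) n]
  have h : harmonicDiff (κ : ℂ) b ≠ 0 := by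
    rw [← ofReal_harmonicDiff]
    exact_mod_cast (harmonicDiff_pos hκ hb).ne'
  simp only [← div_div]
  rw [← sum_div, ← harmonicDiff_eq_sum_range, div_self h]

lemma sum_sum_rootTerm (hκ : -1 < κ) {b : ℕ} (hb : 1 ≤ b) (n : ℕ) :
    ∑ m ∈ range b, ∑ l ∈ (indicialPoly b κ).roots.toFinset,
      rootTerm b κ (n + 1) (m + 1) l = 1 := by
  rw [sum_comm, sum_eq_single ((κ : ℂ) + 1), sum_rootTerm_add_one hκ hb]
  · exact fun l hl hne => sum_range_rootTerm_eq_zero hb n (Multiset.mem_toFinset.1 hl) hne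
  · exact fun h => absurd (Multiset.mem_toFinset.2 (add_one_mem_roots hb)) h

lemma rootTerm_succ (hκ : -1 < κ) {b m : ℕ} (h : m + 1 < b) (n : ℕ) (l : ℂ) :
    ((n : ℂ) + 1 + κ) * rootTerm b κ (n + 1 + 1) (m + 1 + 1) l =
      ((n : ℂ) - (m + 1 : ℕ)) * rootTerm b κ (n + 1) (m + 1 + 1) l +
        (((m + 1 : ℕ) : ℂ) + κ) * rootTerm b κ (n + 1) (m + 1) l := by
  have h1 := bucketNumerator_succ h (κ : ℂ) l
  have h2 := complex_add_one_add_natCast_ne_zero hκ n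
  have h3 : ((m + 1 : ℕ) : ℂ) + κ = κ + 1 + m := by push_cast; ring
  have h4 : (n : ℂ) + 1 + κ = κ + 1 + n := by ring
  have h5 : (n : ℂ) - (m + 1 : ℕ) = (l + n) - (l + (m + 1 : ℕ)) := by ring
  rw [rootTerm_eq b κ _ h, rootTerm_eq b κ _ h, rootTerm_eq b κ _ (by omega), h3, h4, h5,
    prod_range_succ, prod_range_succ,
    mul_div_mul_comm (∏ j ∈ range n, (l + j)) (l + n)]
  generalize (∏ j ∈ range n, (l + j)) / (∏ j ∈ range n, ((κ : ℂ) + 1 + j)) = W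
  generalize (∏ j ∈ range b, ((κ : ℂ) + 1 + j)) * harmonicDiff (l - 1) b = D
  simp only [div_eq_mul_inv _ D]
  calc _ = ((κ + 1 + n) / (κ + 1 + n)) * (l + n) * W * bucketNumerator b (κ : ℂ) l (m + 1) * D⁻¹ := by
        ring
    _ = (l + n) * W * bucketNumerator b (κ : ℂ) l (m + 1) * D⁻¹ := by rw [div_self h2, one_mul]
    _ = _ := by linear_combination W * D⁻¹ * h1

lemma IsLastBucketSequence.sum_range_eq_one {b : ℕ} {q : ℕ → ℕ → ℝ}
    (hq : IsLastBucketSequence b κ q) (n : ℕ) : ∑ m ∈ range b, q n (m + 1) = 1 := by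
  rw [← hq.sum_eq_one n, range_eq_Ico]
  exact sum_Ico_add' (q n) 0 b 1

theorem IsLastBucketSequence.eq_sum_rootTerm {b : ℕ} {q : ℕ → ℕ → ℝ}
    (hq : IsLastBucketSequence b κ q) (hb : 1 ≤ b) (hκ : -1 < κ)
    (hnd : (indicialPoly b κ).roots.Nodup) (n : ℕ) :
    ∀ m < b, ((q n (m + 1) : ℝ) : ℂ) =
      ∑ l ∈ (indicialPoly b κ).roots.toFinset, rootTerm b κ (n + 1) (m + 1) l := by
  induction n with
  | zero =>
    intro m hm
    rw [hq.zero, sum_congr rfl fun l _ => rootTerm_eq b κ 0 hm l]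
    simp only [range_zero, prod_empty, div_one, one_mul]
    rw [sum_bucketNumerator_div hκ hnd hm]
    by_cases h : m = 0 <;> simp [h]
  | succ n ih =>
    have hsucc : ∀ m, m + 1 < b → ((q (n + 1) (m + 1 + 1) : ℝ) : ℂ) =
        ∑ l ∈ (indicialPoly b κ).roots.toFinset, rootTerm b κ (n + 1 + 1) (m + 1 + 1) l := by
      intro m hm
      have h4 : (n : ℂ) + 1 + κ ≠ 0 := by
        have := complex_add_one_add_natCast_ne_zero hκ n
        rwa [show (n : ℂ) + 1 + κ = κ + 1 + n by ring]
      apply mul_left_cancel₀ h4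
      rw [mul_sum, sum_congr rfl fun l _ => rootTerm_succ hκ hm n l, sum_add_distrib, ← mul_sum,
        ← mul_sum, ← ih _ hm, ← ih m (by omega)]
      exact_mod_cast hq.succ n (m + 1) (by omega) hm
    intro m hm
    cases m with
    | succ m => exact hsucc m hm
    | zero =>
      -- The recurrence says nothing about size `1`. Both families have total mass one and agree at
      -- all other sizes.
      obtain ⟨c, rfl⟩ : ∃ c, b = c + 1 := ⟨b - 1, by omega⟩
      have h1 := sum_sum_rootTerm hκ hb (n + 1)
      have h2 : ∑ m ∈ range (c + 1), ((q (n + 1) (m + 1) : ℝ) : ℂ) = 1 := by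
        exact_mod_cast hq.sum_range_eq_one (n + 1)
      rw [sum_range_succ'] at h1 h2
      rw [sum_congr rfl fun m hm => hsucc m (by simpa using hm)] at h2
      exact add_left_cancel (h2.trans h1.symm)

end

/-! ### Location and multiplicity of the roots. -/

section Roots

variable {κ : ℝ}

/-- If `l.re ≥ κ + 1`, every factor satisfies `‖l + j‖ ≥ κ + 1 + j`, strictly at `j = 0` unless `l =
κ + 1`. The two products would then differ in norm. -/
lemma re_lt_of_mem_roots (hκ : -1 < κ) {b : ℕ} (hb : 1 ≤ b) {l : ℂ}
    (hl : l ∈ (indicialPoly b κ).roots) (hne : l ≠ κ + 1) : l.re < κ + 1 := by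
  by_contra! hre
  have hl' := congrArg norm ((mem_roots_indicialPoly hb κ).1 hl)
  rw [norm_prod, norm_prod] at hl'
  have hnorm : ∀ j : ℕ, ‖(κ : ℂ) + 1 + j‖ = κ + 1 + j := by
    intro j
    have : (κ : ℂ) + 1 + j = ((κ + 1 + j : ℝ) : ℂ) := by push_cast; rfl
    rw [this, Complex.norm_real, Real.norm_of_nonneg (add_one_add_natCast_pos hκ j).le]
  have hle : ∀ j : ℕ, κ + 1 + j ≤ ‖l + j‖ := by
    intro j
    have := Complex.re_le_norm (l + j)
    simp only [Complex.add_re, Complex.natCast_re] at this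
    linarith
  have hlt : κ + 1 + (0 : ℕ) < ‖l + (0 : ℕ)‖ := by
    simp only [Nat.cast_zero, add_zero]
    refine lt_of_le_of_ne (by simpa using hle 0) fun heq => hne ?_
    have h1 : l.re = ‖l‖ := le_antisymm (Complex.re_le_norm l) (heq ▸ hre)
    have h2 := Complex.re_add_im l
    have h3 : l.im = 0 := by
      rw [← Complex.abs_re_eq_norm, h1, abs_norm]
    rw [h3, h1, ← heq] at h2
    rw [← h2]
    push_cast
    ring
  refine absurd hl' (ne_of_gt ?_)
  refine prod_lt_prod (fun j _ => ?_) (fun j _ => ?_) ⟨0, by simp; omega, ?_⟩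
  · rw [hnorm]; exact add_one_add_natCast_pos hκ j
  · rw [hnorm]; exact hle j
  · rw [hnorm]; exact hlt

lemma harmonicDiff_eq_zero_of_one_lt_count (hκ : -1 < κ) {b : ℕ} (hb : 1 ≤ b) {l : ℂ}
    (h : 1 < (indicialPoly b κ).roots.count l) :
    l ∈ (indicialPoly b κ).roots ∧ (Polynomial.derivative (ascPochhammer ℂ b)).eval l = 0 ∧
      harmonicDiff (l - 1) b = 0 := by
  have hl : l ∈ (indicialPoly b κ).roots := Multiset.count_pos.1 (by omega)
  rw [Polynomial.count_roots, Polynomial.one_lt_rootMultiplicity_iff_isRoot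
    (indicialPoly_monic hb κ).ne_zero] at h
  have h2 := h.2
  refine ⟨hl, by rw [← indicialPoly_derivative b κ]; exact h2, ?_⟩
  rw [Polynomial.IsRoot, derivative_indicialPoly_eval_of_mem_roots hκ hb hl] at h2
  exact (mul_eq_zero.1 h2).resolve_left (prod_add_one_add_ne_zero hκ b)

lemma count_add_one_roots (hκ : -1 < κ) {b : ℕ} (hb : 1 ≤ b) :
    (indicialPoly b κ).roots.count ((κ : ℂ) + 1) = 1 := by
  refine le_antisymm ?_ (Multiset.one_le_count_iff_mem.2 (add_one_mem_roots hb))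
  by_contra! h
  have h1 := (harmonicDiff_eq_zero_of_one_lt_count hκ hb h).2.2
  rw [add_sub_cancel_right, ← ofReal_harmonicDiff] at h1
  exact (harmonicDiff_pos hκ hb).ne' (by exact_mod_cast h1)

lemma exists_one_lt_count_of_not_nodup {b : ℕ} (h : ¬ (indicialPoly b κ).roots.Nodup) :
    ∃ l, 1 < (indicialPoly b κ).roots.count l := by
  simpa [Multiset.nodup_iff_count_le_one] using h

/-- The imaginary part of `1 / (l + j)` is `-l.im / ‖l + j‖ ^ 2`, so the summands cannot cancel
unless `l.im = 0`. -/
lemma im_eq_zero_of_harmonicDiff_eq_zero {b : ℕ} (hb : 1 ≤ b) {l : ℂ}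
    (hne : ∀ j ∈ range b, l + j ≠ 0) (h : harmonicDiff (l - 1) b = 0) : l.im = 0 := by
  rw [harmonicDiff_eq_sum_range] at h
  have h1 := congrArg Complex.im h
  simp only [sub_add_cancel, Complex.im_sum, one_div, Complex.inv_im, Complex.add_im,
    Complex.natCast_im, add_zero, Complex.zero_im, neg_div] at h1
  rw [sum_neg_distrib, neg_eq_zero] at h1
  simp only [div_eq_mul_inv] at h1
  rw [← mul_sum] at h1
  refine (mul_eq_zero.1 h1).resolve_right (ne_of_gt ?_)
  exact sum_pos (fun j hj => inv_pos.2 (Complex.normSq_pos.2 (hne j hj))) ⟨0, by simp; omega⟩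

lemma mem_Ioo_of_sum_one_div_eq_zero {b : ℕ} (hb : 1 ≤ b) {x : ℝ}
    (hne : ∀ j ∈ range b, x + j ≠ 0) (h : ∑ j ∈ range b, 1 / (x + j) = 0) :
    x ∈ Set.Ioo (-((b : ℝ) - 1)) 0 := by
  have hnonempty : (range b).Nonempty := ⟨0, by simp; omega⟩
  constructor
  · by_contra! hx
    refine absurd h (ne_of_lt (sum_neg (fun j hj => ?_) hnonempty))
    have h1 : (j : ℝ) + 1 ≤ b := by exact_mod_cast mem_range.1 hj
    exact one_div_neg.2 (lt_of_le_of_ne (by linarith) (hne j hj))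
  · by_contra! hx
    refine absurd h (ne_of_gt (sum_pos (fun j hj => ?_) hnonempty))
    have h1 : (0 : ℝ) ≤ j := j.cast_nonneg
    exact one_div_pos.2 (lt_of_le_of_ne (by linarith) (hne j hj).symm)

/-- The base case is `|x (x + 1)| ≤ 1/4` on `[-1, 0]`. In the induction, one drops the last factor,
or drops the first and shifts `x` by one, so that the remaining product falls under the previous
case; the dropped factor is at most `b + 2` in absolute value. -/
lemma abs_prod_range_add_le (b : ℕ) : ∀ x ∈ Set.Icc (-((b : ℝ) + 1)) 0,
    |∏ j ∈ range (b + 2), (x + j)| ≤ ((b + 1).factorial : ℝ) / 4 := by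
  induction b with
  | zero =>
    intro x hx
    simp only [CharP.cast_eq_zero, zero_add, Set.mem_Icc] at hx
    rw [abs_le]
    simp only [zero_add, prod_range_succ, range_zero, prod_empty, one_mul, Nat.cast_zero, add_zero,
      Nat.cast_one, Nat.factorial_one]
    constructor <;> nlinarith [sq_nonneg (x + 1 / 2)]
  | succ b ih =>
    intro x hx
    simp only [Nat.cast_add, Nat.cast_one, Set.mem_Icc] at hx
    have hpos : (0 : ℝ) ≤ ((b + 1).factorial : ℝ) / 4 := by positivity
    have hb : (0 : ℝ) ≤ b := b.cast_nonneg
    have key : ∀ y z : ℝ, |y| ≤ ((b + 1).factorial : ℝ) / 4 → |z| ≤ (b : ℝ) + 2 →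
        |y * z| ≤ ((b + 1 + 1).factorial : ℝ) / 4 := by
      intro y z hy hz
      rw [abs_mul, Nat.factorial_succ (b + 1)]
      push_cast
      calc |y| * |z| ≤ ((b + 1).factorial : ℝ) / 4 * ((b : ℝ) + 2) :=
            mul_le_mul hy hz (abs_nonneg _) hpos
        _ = _ := by ring
    by_cases h : -((b : ℝ) + 1) ≤ x
    · rw [prod_range_succ]
      refine key _ _ (ih x ⟨h, hx.2⟩) ?_
      push_cast
      rw [abs_le]
      constructor <;> linarith
    · rw [prod_range_succ']
      have h1 : ∏ j ∈ range (b + 2), (x + ((j + 1 : ℕ) : ℝ)) =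
          ∏ j ∈ range (b + 2), (x + 1 + j) :=
        prod_congr rfl fun j _ => by push_cast; ring
      rw [h1]
      refine key _ _ (ih (x + 1) ⟨by linarith, by linarith⟩) ?_
      rw [abs_le]
      constructor <;> simp only [Nat.cast_zero, add_zero] <;> linarith

/-- The factor `j = 0` is at least `1/2` and each later factor is at least `j`, so the product is at
least `b! / 2`. -/
lemma factorial_div_four_lt_prod (hκ : -(1 / 2) ≤ κ) (b : ℕ) :
    (b.factorial : ℝ) / 4 < ∏ j ∈ range (b + 1), (κ + 1 + j) := by
  have h : (b.factorial : ℝ) / 2 ≤ ∏ j ∈ range (b + 1), (κ + 1 + j) := by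
    induction b with
    | zero => simp; linarith
    | succ b ih =>
      rw [prod_range_succ, Nat.factorial_succ]
      push_cast
      calc ((b : ℝ) + 1) * b.factorial / 2 = (b.factorial : ℝ) / 2 * (b + 1) := by ring
        _ ≤ _ := mul_le_mul ih (by linarith) (by positivity) (le_trans (by positivity) ih)
  have : (0 : ℝ) < b.factorial := by exact_mod_cast b.factorial_pos
  linarith

theorem nodup_roots_indicialPoly (hκ : -(1 / 2) ≤ κ) {b : ℕ} (hb : 1 ≤ b) :
    (indicialPoly b κ).roots.Nodup := by
  have hκ' : -1 < κ := by linarith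
  by_contra hnd
  obtain ⟨l, hcount⟩ := exists_one_lt_count_of_not_nodup hnd
  obtain ⟨hl, -, hH⟩ := harmonicDiff_eq_zero_of_one_lt_count hκ' hb hcount
  have hne := add_natCast_ne_zero_of_mem_roots hκ' hb hl
  have him := im_eq_zero_of_harmonicDiff_eq_zero hb hne hH
  obtain ⟨x, rfl⟩ : ∃ x : ℝ, l = x := ⟨l.re, by rw [← Complex.re_add_im l, him]; simp⟩
  have hroot := (mem_roots_indicialPoly hb κ).1 hl
  rw [harmonicDiff_eq_sum_range] at hH
  simp only [sub_add_cancel] at hH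
  norm_cast at hH hroot hne
  have hx := mem_Ioo_of_sum_one_div_eq_zero hb hne (by simpa using hH)
  -- For `b = 1` the interval containing `x` is empty.
  have hb2 : 2 ≤ b := by
    by_contra! hb2
    obtain rfl : b = 1 := by omega
    simp at hx
  obtain ⟨c, rfl⟩ : ∃ c, b = c + 2 := ⟨b - 2, by omega⟩
  push_cast at hx
  have h1 := abs_prod_range_add_le c x ⟨by linarith [hx.1], hx.2.le⟩
  have h2 := factorial_div_four_lt_prod hκ (c + 1)
  rw [hroot] at h1
  exact absurd (h2.trans_le (le_abs_self _)) (not_lt.2 h1)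

lemma strictMonoOn_prod_add_one_add {b : ℕ} (hb : 1 ≤ b) :
    StrictMonoOn (fun κ : ℝ => ∏ j ∈ range b, (κ + 1 + j)) (Set.Ioi (-1)) := by
  intro κ hκ κ' _ h
  exact prod_lt_prod (fun j _ => add_one_add_natCast_pos hκ j) (fun j _ => by linarith)
    ⟨0, by simp; omega, by linarith⟩

/-- The derivative of the indicial polynomial does not depend on `κ`. A multiple root is one of its
finitely many zeros, and the value of the rising factorial there determines `κ` by strict
monotonicity. -/
theorem finite_not_nodup_roots_indicialPoly {b : ℕ} (hb : 1 ≤ b) :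
    {κ : ℝ | -1 < κ ∧ ¬ (indicialPoly b κ).roots.Nodup}.Finite := by
  have hne : Polynomial.derivative (ascPochhammer ℂ b) ≠ 0 := fun h => by
    have := Polynomial.derivative_eq_zero.1 h
    rw [ascPochhammer_natDegree] at this
    omega
  refine Set.Finite.of_finite_image (f := fun κ : ℝ => ((∏ j ∈ range b, (κ + 1 + j) : ℝ) : ℂ))
    (((Polynomial.derivative (ascPochhammer ℂ b)).roots.toFinset.image fun l =>
      (ascPochhammer ℂ b).eval l).finite_toSet.subset ?_) ?_
  · rintro _ ⟨κ, ⟨hκ, hnd⟩, rfl⟩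
    obtain ⟨l, hcount⟩ := exists_one_lt_count_of_not_nodup hnd
    obtain ⟨hl, hd, -⟩ := harmonicDiff_eq_zero_of_one_lt_count hκ hb hcount
    rw [mem_coe, mem_image]
    refine ⟨l, ?_, ?_⟩
    · rw [Multiset.mem_toFinset, Polynomial.mem_roots hne]
      exact hd
    · rw [ascPochhammer_eval_eq_prod_range, (mem_roots_indicialPoly hb κ).1 hl]
      push_cast
      rfl
  · intro κ hκ κ' hκ' h
    exact (strictMonoOn_prod_add_one_add hb).injOn hκ.1 hκ'.1 (Complex.ofReal_injective h)

end Roots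

/-! ### Convergence through a first-order difference operator. -/

section Convergence

variable {κ : ℝ}

lemma tendsto_sum_div_add_atTop (hκ : -1 < κ) {c : ℝ} (hc : 0 < c) :
    Tendsto (fun n => ∑ i ∈ range n, c / (κ + 1 + i)) atTop atTop := by
  have hnn : ∀ i : ℕ, 0 ≤ c / (κ + 1 + i) := fun i =>
    div_nonneg hc.le (add_one_add_natCast_pos hκ i).le
  rw [← not_summable_iff_tendsto_nat_atTop_of_nonneg hnn]
  intro hs
  have h1 : Summable fun i : ℕ => 1 / ((i : ℝ) + 1) := by
    -- The constant comes from `κ + 1 + i ≤ (1 + |κ|) (i + 1)`.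
    refine Summable.of_nonneg_of_le (fun i => by positivity) (fun i => ?_)
      (hs.mul_left ((1 + |κ|) / c))
    have hpos := add_one_add_natCast_pos hκ i
    rw [div_mul_div_comm, mul_comm c, mul_div_mul_right _ _ hc.ne',
      div_le_div_iff₀ (by positivity) hpos]
    have h2 := le_abs_self κ
    have h3 : (0 : ℝ) ≤ i := i.cast_nonneg
    nlinarith [mul_nonneg (abs_nonneg κ) h3]
  refine Real.not_summable_one_div_natCast ((summable_nat_add_iff 1).1 ?_)
  simpa using h1

/-- Discrete Gronwall-type lemma: a nonnegative sequence that contracts by `1 - c / (n+1+κ)` in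
each step, up to an error `o(1 / n)`, tends to zero. -/
lemma tendsto_zero_of_le_one_sub_div_mul_add (hκ : -1 < κ) {c : ℝ} (hc : 0 < c) {u ε : ℕ → ℝ}
    (hu : ∀ n, 0 ≤ u n) (hε : Tendsto ε atTop (𝓝 0))
    (h : ∀ᶠ n : ℕ in atTop, u (n + 1) ≤ (1 - c / (κ + 1 + n)) * u n + ε n / (κ + 1 + n)) :
    Tendsto u atTop (𝓝 0) := by
  rw [Metric.tendsto_atTop]
  intro δ hδ
  have h1 : ∀ᶠ n in atTop, ε n < c * (δ / 2) := hε.eventually_lt_const (by positivity)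
  have h2 : ∀ᶠ n : ℕ in atTop, c ≤ κ + 1 + n :=
    (tendsto_atTop_add_const_left _ _ tendsto_natCast_atTop_atTop).eventually_ge_atTop c
  obtain ⟨N, hN⟩ := eventually_atTop.1 (h.and (h1.and h2))
  -- Once `ε n < c * (δ / 2)`, the shifted sequence `u n - δ / 2` contracts with no error term. The
  -- product of the contraction factors is bounded by the exponential of minus the increment of `S`,
  -- and `S` diverges.
  set S : ℕ → ℝ := fun n => ∑ i ∈ range n, c / (κ + 1 + i) with hS
  set B : ℝ := |u N - δ / 2| * Real.exp (S N) with hB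
  have hB0 : 0 ≤ B := by positivity
  have hbound : ∀ n, N ≤ n → u n - δ / 2 ≤ B * Real.exp (-S n) := by
    intro n hn
    induction n, hn using Nat.le_induction with
    | base =>
      rw [hB, mul_assoc, ← Real.exp_add, add_neg_cancel, Real.exp_zero, mul_one]
      exact le_abs_self _
    | succ n hn ih =>
      obtain ⟨h3, h4, h5⟩ := hN n hn
      have hpos := add_one_add_natCast_pos hκ n
      have ha : c / (κ + 1 + n) ≤ 1 := (div_le_one hpos).2 h5
      have h6 : ε n / (κ + 1 + n) ≤ c / (κ + 1 + n) * (δ / 2) := by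
        rw [div_mul_eq_mul_div]
        exact div_le_div_of_nonneg_right h4.le hpos.le
      have h7 : S (n + 1) = S n + c / (κ + 1 + n) := sum_range_succ _ _
      calc u (n + 1) - δ / 2 ≤ (1 - c / (κ + 1 + n)) * (u n - δ / 2) := by linarith
        _ ≤ (1 - c / (κ + 1 + n)) * (B * Real.exp (-S n)) :=
            mul_le_mul_of_nonneg_left ih (by linarith)
        _ ≤ Real.exp (-(c / (κ + 1 + n))) * (B * Real.exp (-S n)) :=
            mul_le_mul_of_nonneg_right (Real.one_sub_le_exp_neg _) (by positivity)
        _ = B * Real.exp (-S (n + 1)) := by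
            rw [h7, neg_add, Real.exp_add]
            ring
  have hlim : Tendsto (fun n => B * Real.exp (-S n)) atTop (𝓝 0) := by
    have := (Real.tendsto_exp_neg_atTop_nhds_zero.comp (tendsto_sum_div_add_atTop hκ hc)).const_mul B
    simpa using this
  obtain ⟨M, hM⟩ := eventually_atTop.1 (hlim.eventually_lt_const (half_pos hδ))
  refine ⟨max N M, fun n hn => ?_⟩
  rw [Real.dist_eq, sub_zero, abs_of_nonneg (hu n)]
  have h3 := hbound n (le_of_max_le_left hn)
  have h4 := hM n (le_of_max_le_right hn)
  linarith

/-- The operator on sequences given by `y ↦ ((n+1+κ) (y (n+1) - y n) + (κ+1) y n)ₙ`. -/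
noncomputable def eulerOp (κ : ℝ) : Module.End ℂ (ℕ → ℂ) where
  toFun y n := ((κ : ℂ) + 1 + n) * (y (n + 1) - y n) + ((κ : ℂ) + 1) * y n
  map_add' y z := by ext n; simp only [Pi.add_apply]; ring
  map_smul' a y := by ext n; simp only [Pi.smul_apply, smul_eq_mul, RingHom.id_apply]; ring

lemma eulerOp_apply (κ : ℝ) (y : ℕ → ℂ) (n : ℕ) :
    eulerOp κ y n = ((κ : ℂ) + 1 + n) * (y (n + 1) - y n) + ((κ : ℂ) + 1) * y n := rfl

/-- The squared norm is `1 - 4c/t + ‖μ‖²/t²`. Half of the first-order gain `4c/t` absorbs the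
quadratic term once `‖μ‖² ≤ 2ct`, which is why `μ.re` is `-(2c)` and the bound only claims `c`. -/
lemma norm_one_add_div_le {μ : ℂ} {c t : ℝ} (hc : 0 < c) (hμ : μ.re = -(2 * c)) (hct : c ≤ t)
    (ht : ‖μ‖ ^ 2 / (2 * c) ≤ t) : ‖1 + μ / (t : ℂ)‖ ≤ 1 - c / t := by
  have ht0 : 0 < t := hc.trans_le hct
  have h1 : c / t ≤ 1 := (div_le_one ht0).2 hct
  refine le_of_sq_le_sq ?_ (by linarith)
  rw [div_le_iff₀ (by positivity)] at ht
  have h2 : ‖μ‖ ^ 2 = μ.re * μ.re + μ.im * μ.im := by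
    rw [← Complex.normSq_eq_norm_sq, Complex.normSq_apply]
  rw [← Complex.normSq_eq_norm_sq, Complex.normSq_apply]
  simp only [Complex.add_re, Complex.one_re, Complex.div_ofReal_re, Complex.add_im, Complex.one_im,
    Complex.div_ofReal_im, zero_add]
  rw [h2, hμ] at ht
  rw [hμ]
  have h3 : (1 - c / t) ^ 2 - ((1 + -(2 * c) / t) * (1 + -(2 * c) / t) + μ.im / t * (μ.im / t)) =
      (2 * c * t + c ^ 2 - (4 * c ^ 2 + μ.im * μ.im)) / t ^ 2 := by
    field_simp
    ring
  have h4 : 0 ≤ (2 * c * t + c ^ 2 - (4 * c ^ 2 + μ.im * μ.im)) / t ^ 2 :=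
    div_nonneg (by nlinarith) (by positivity)
  linarith

/-- With `μ = l - (κ + 1)`, solving for `y (n + 1)` gives the factor `1 + μ / (κ + 1 + n)` and an
error `o(1 / n)`; since `μ.re < 0`, the Gronwall-type lemma applies to `‖y n‖`. -/
lemma tendsto_zero_of_eulerOp_sub (hκ : -1 < κ) {l : ℂ} (hl : l.re < κ + 1) {y : ℕ → ℂ}
    (h : Tendsto (fun n => eulerOp κ y n - l * y n) atTop (𝓝 0)) : Tendsto y atTop (𝓝 0) := by
  set c : ℝ := (κ + 1 - l.re) / 2 with hc
  have hc0 : 0 < c := by linarith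
  set μ : ℂ := l - (κ + 1) with hμ
  have hμre : μ.re = -(2 * c) := by simp [hμ, hc]; ring
  rw [tendsto_zero_iff_norm_tendsto_zero] at h ⊢
  refine tendsto_zero_of_le_one_sub_div_mul_add hκ hc0 (fun n => norm_nonneg _) h ?_
  have ht : Tendsto (fun n : ℕ => κ + 1 + (n : ℝ)) atTop atTop :=
    tendsto_atTop_add_const_left _ _ tendsto_natCast_atTop_atTop
  filter_upwards [ht.eventually_ge_atTop c, ht.eventually_ge_atTop (‖μ‖ ^ 2 / (2 * c))]
    with n h1 h2
  have hpos := add_one_add_natCast_pos hκ n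
  have hne := complex_add_one_add_natCast_ne_zero hκ n
  have hnorm : ‖(κ : ℂ) + 1 + n‖ = κ + 1 + n := by
    have : (κ : ℂ) + 1 + n = ((κ + 1 + n : ℝ) : ℂ) := by push_cast; rfl
    rw [this, Complex.norm_real, Real.norm_of_nonneg hpos.le]
  have hstep : y (n + 1) = (1 + μ / ((κ + 1 + n : ℝ) : ℂ)) * y n +
      (eulerOp κ y n - l * y n) / ((κ : ℂ) + 1 + n) := by
    rw [eulerOp_apply]
    push_cast
    field_simp
    rw [hμ]
    ring
  calc ‖y (n + 1)‖ ≤ ‖1 + μ / ((κ + 1 + n : ℝ) : ℂ)‖ * ‖y n‖ +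
        ‖eulerOp κ y n - l * y n‖ / (κ + 1 + n) := by
        rw [hstep, ← norm_mul]
        refine (norm_add_le _ _).trans_eq ?_
        rw [norm_div (eulerOp κ y n - l * y n), hnorm]
    _ ≤ _ := add_le_add (mul_le_mul_of_nonneg_right (norm_one_add_div_le hc0 hμre h1 h2)
        (norm_nonneg _)) le_rfl

lemma aeval_X_sub_C_apply (T : Module.End ℂ (ℕ → ℂ)) (l : ℂ) (y : ℕ → ℂ) :
    Polynomial.aeval T (Polynomial.X - Polynomial.C l) y = fun n => T y n - l * y n := by
  ext n
  simp [Module.algebraMap_end_apply]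

lemma tendsto_zero_of_aeval_eulerOp (hκ : -1 < κ) (s : Multiset ℂ) (hs : ∀ l ∈ s, l.re < κ + 1)
    (y : ℕ → ℂ)
    (h : Polynomial.aeval (eulerOp κ)
      (s.map fun l => Polynomial.X - Polynomial.C l).prod y = 0) : Tendsto y atTop (𝓝 0) := by
  induction s using Multiset.induction_on generalizing y with
  | empty =>
    have : y = 0 := by simpa using h
    rw [this]
    exact tendsto_const_nhds
  | cons l s ih =>
    rw [Multiset.map_cons, Multiset.prod_cons, mul_comm, map_mul, Module.End.mul_apply] at h
    have := ih (fun l hl => hs l (Multiset.mem_cons_of_mem hl)) _ h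
    rw [aeval_X_sub_C_apply] at this
    exact tendsto_zero_of_eulerOp_sub hκ (hs l (Multiset.mem_cons_self l s)) this

lemma tendsto_of_aeval_indicialPoly_eq_zero (hκ : -1 < κ) {b : ℕ} (hb : 1 ≤ b) {y : ℕ → ℂ}
    (h : Polynomial.aeval (eulerOp κ) (indicialPoly b κ) y = 0) :
    Tendsto (fun n => ((κ : ℂ) + 1 + n) * (y (n + 1) - y n)) atTop (𝓝 0) := by
  -- Split off the root `κ + 1`, whose factor sends `y` to `(κ + 1 + n) (y (n + 1) - y n)`. As this
  -- root is simple, the remaining ones, possibly repeated, all have smaller real part.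
  obtain ⟨s, hs⟩ := Multiset.exists_cons_of_mem (add_one_mem_roots (κ := κ) hb)
  have hcount := count_add_one_roots hκ hb
  rw [hs, Multiset.count_cons_self] at hcount
  have hnot : (κ : ℂ) + 1 ∉ s := Multiset.count_eq_zero.1 (by omega)
  rw [indicialPoly_eq_prod_roots hb, hs, Multiset.map_cons, Multiset.prod_cons, mul_comm, map_mul,
    Module.End.mul_apply] at h
  have := tendsto_zero_of_aeval_eulerOp hκ s (fun l hl => re_lt_of_mem_roots hκ hb
    (hs ▸ Multiset.mem_cons_of_mem hl) fun heq => hnot (heq ▸ hl)) _ h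
  rw [aeval_X_sub_C_apply] at this
  simpa [eulerOp_apply] using this

namespace IsLastBucketSequence

variable {b : ℕ} {q : ℕ → ℕ → ℝ}

lemma sub_succ (hq : IsLastBucketSequence b κ q) {m : ℕ} (hm : m + 1 < b) (n : ℕ) :
    ((κ : ℂ) + 1 + n) * (q (n + 1) (m + 1 + 1) - q n (m + 1 + 1)) =
      ((κ : ℂ) + 1 + m) * q n (m + 1) - ((κ : ℂ) + 1 + (m + 1 : ℕ)) * q n (m + 1 + 1) := by
  have h : ((n : ℂ) + 1 + κ) * q (n + 1) (m + 1 + 1) =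
      ((n : ℂ) - (m + 1 : ℕ)) * q n (m + 1 + 1) + ((m + 1 : ℕ) + κ) * q n (m + 1) := by
    exact_mod_cast hq.succ n (m + 1) (by omega) hm
  push_cast at h ⊢
  linear_combination h

lemma eulerOp_succ (hq : IsLastBucketSequence b κ q) {m : ℕ} (hm : m + 1 < b) :
    Polynomial.aeval (eulerOp κ) (Polynomial.X + Polynomial.C ((m + 1 : ℕ) : ℂ))
        (fun n => (q n (m + 1 + 1) : ℂ)) =
      ((κ : ℂ) + 1 + m) • fun n => (q n (m + 1) : ℂ) := by
  ext n
  have h := hq.sub_succ hm n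
  simp only [map_add, Polynomial.aeval_X, Polynomial.aeval_C, LinearMap.add_apply,
    Module.algebraMap_end_apply, Pi.add_apply, Pi.smul_apply, smul_eq_mul, eulerOp_apply]
  linear_combination h

/-- The total mass is constant, so the increment at size `1` is minus the sum of the others, which
telescopes. This closes the chain of `eulerOp_succ` cyclically, from size `1` back to size `b`. -/
lemma eulerOp_one {c : ℕ} (hq : IsLastBucketSequence (c + 1) κ q) :
    eulerOp κ (fun n => (q n 1 : ℂ)) = ((κ : ℂ) + 1 + c) • fun n => (q n (c + 1) : ℂ) := by
  ext n
  have h1 : ∀ n, ∑ m ∈ range (c + 1), (q n (m + 1) : ℂ) = 1 := fun n => by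
    exact_mod_cast hq.sum_range_eq_one n
  have h2 : ∑ m ∈ range c, ((κ : ℂ) + 1 + n) * (q (n + 1) (m + 1 + 1) - q n (m + 1 + 1)) =
      ((κ : ℂ) + 1 + (0 : ℕ)) * q n (0 + 1) - ((κ : ℂ) + 1 + c) * q n (c + 1) := by
    rw [← sum_range_sub' (fun m : ℕ => ((κ : ℂ) + 1 + m) * (q n (m + 1) : ℂ))]
    exact sum_congr rfl fun m hm => hq.sub_succ (by simpa using hm) n
  have h3 := h1 n
  have h4 := h1 (n + 1)
  rw [sum_range_succ'] at h3 h4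
  rw [← mul_sum, sum_sub_distrib] at h2
  simp only [zero_add, Nat.cast_zero, add_zero] at h2 h3 h4
  simp only [eulerOp_apply, Pi.smul_apply, smul_eq_mul]
  linear_combination ((κ : ℂ) + 1 + n) * (h4 - h3) - h2

lemma aeval_prod_Ico {c : ℕ} (hq : IsLastBucketSequence (c + 1) κ q) (k : ℕ) (hk : k ≤ c) :
    Polynomial.aeval (eulerOp κ)
        (∏ j ∈ Ico (c - k + 1) (c + 1), (Polynomial.X + Polynomial.C (j : ℂ)))
        (fun n => (q n (c + 1) : ℂ)) =
      (∏ j ∈ Ico (c - k) c, ((κ : ℂ) + 1 + j)) • fun n => (q n (c - k + 1) : ℂ) := by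
  induction k with
  | zero => simp
  | succ k ih =>
    obtain ⟨m, hm⟩ : ∃ m, c - (k + 1) = m := ⟨_, rfl⟩
    have hm' : c - k = m + 1 := by omega
    rw [hm'] at ih
    rw [hm, prod_eq_prod_Ico_succ_bot (by omega : m + 1 < c + 1),
      prod_eq_prod_Ico_succ_bot (by omega : m < c), map_mul, Module.End.mul_apply,
      ih (by omega), map_smul, hq.eulerOp_succ (by omega), smul_smul, mul_comm]

/-- Applying the factors `X + j` for `j = c, …, 1` descends from size `c + 1` to size `1`, and the
factor `X` returns to size `c + 1` with the total multiplier `∏ (κ + 1 + j)`. Every other size is a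
nonzero multiple of a polynomial in the operator applied to size `c + 1`, and such polynomials
commute. -/
lemma aeval_indicialPoly {c : ℕ} (hq : IsLastBucketSequence (c + 1) κ q) (hκ : -1 < κ) {m : ℕ}
    (hm : m < c + 1) :
    Polynomial.aeval (eulerOp κ) (indicialPoly (c + 1) κ) (fun n => (q n (m + 1) : ℂ)) = 0 := by
  have hlast : Polynomial.aeval (eulerOp κ) (indicialPoly (c + 1) κ)
      (fun n => (q n (c + 1) : ℂ)) = 0 := by
    have h := hq.aeval_prod_Ico c le_rfl
    rw [Nat.sub_self] at h
    rw [indicialPoly_eq, ascPochhammer_eq_prod_X_add_C, range_eq_Ico,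
      prod_eq_prod_Ico_succ_bot (by omega : 0 < c + 1), map_sub, map_mul, LinearMap.sub_apply,
      Module.End.mul_apply, h, map_smul]
    simp only [Nat.cast_zero, Polynomial.C_0, add_zero, Polynomial.aeval_X, zero_add]
    rw [hq.eulerOp_one, smul_smul, Polynomial.aeval_C, Module.algebraMap_end_apply, ← range_eq_Ico,
      ← range_eq_Ico, prod_range_succ, sub_self]
  have h := hq.aeval_prod_Ico (c - m) (by omega)
  have h1 : c - (c - m) = m := by omega
  rw [h1] at h
  have hne : ∏ j ∈ Ico m c, ((κ : ℂ) + 1 + j) ≠ 0 :=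
    prod_ne_zero_iff.2 fun j _ => complex_add_one_add_natCast_ne_zero hκ j
  have h2 := congrArg (Polynomial.aeval (eulerOp κ) (indicialPoly (c + 1) κ)) h
  rw [← Module.End.mul_apply, ← map_mul, mul_comm, map_mul, Module.End.mul_apply, hlast, map_zero,
    map_smul] at h2
  exact (smul_eq_zero.1 h2.symm).resolve_left hne

theorem tendsto_limitMass (hq : IsLastBucketSequence b κ q) (hb : 1 ≤ b) (hκ : -1 < κ) {m : ℕ}
    (hm : m < b) : Tendsto (fun n => q n (m + 1)) atTop (𝓝 (limitMass b κ (m + 1))) := by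
  obtain ⟨c, rfl⟩ : ∃ c, b = c + 1 := ⟨b - 1, by omega⟩
  -- By the recurrence, this difference equals `(κ + 1 + n)` times an increment of `q`.
  have hdiff : ∀ m, m + 1 < c + 1 → Tendsto (fun n => (κ + 1 + m) * q n (m + 1) -
      (κ + 1 + (m + 1 : ℕ)) * q n (m + 1 + 1)) atTop (𝓝 0) := by
    intro m hm
    have h := tendsto_of_aeval_indicialPoly_eq_zero hκ hb (hq.aeval_indicialPoly hκ hm)
    have h1 := (Complex.continuous_re.tendsto _).comp h
    rw [Complex.zero_re] at h1
    refine h1.congr fun n => ?_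
    rw [Function.comp_apply, hq.sub_succ hm n]
    norm_cast
  have hfirst : ∀ m < c + 1, Tendsto (fun n => q n (m + 1) - (κ + 1) * q n 1 / (κ + 1 + m)) atTop
      (𝓝 0) := by
    intro m hm
    have h : Tendsto (fun n => (κ + 1) * q n 1 - (κ + 1 + m) * q n (m + 1)) atTop (𝓝 0) := by
      induction m with
      | zero => simp
      | succ m ih =>
        have := (ih (by omega)).add (hdiff m hm)
        rw [add_zero] at this
        exact this.congr fun n => by ring
    have h1 := h.div_const (-(κ + 1 + m))
    rw [zero_div] at h1
    refine h1.congr fun n => ?_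
    have := (add_one_add_natCast_pos hκ m).ne'
    field_simp
    ring
  have hH := harmonicDiff_pos hκ hb
  -- Summing `hfirst` over all sizes, the masses give `1` and the coefficients of `(κ + 1) * q n 1`
  -- give `harmonicDiff κ (c + 1)`.
  have hone : Tendsto (fun n => (κ + 1) * q n 1) atTop (𝓝 (1 / harmonicDiff κ (c + 1))) := by
    have h := tendsto_finsetSum (range (c + 1)) fun m hm => hfirst m (mem_range.1 hm)
    rw [sum_const_zero] at h
    have h1 := (h.const_sub 1).div_const (harmonicDiff κ (c + 1))
    rw [sub_zero] at h1
    refine h1.congr fun n => ?_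
    rw [sum_sub_distrib, hq.sum_range_eq_one]
    simp only [div_eq_mul_one_div ((κ + 1) * q n 1)]
    rw [← mul_sum, ← harmonicDiff_eq_sum_range]
    field_simp
    ring
  have h := (hfirst m hm).add (hone.div_const (κ + 1 + m))
  rw [limitMass_eq hκ hm]
  have h2 : (0 : ℝ) + 1 / harmonicDiff κ (c + 1) / (κ + 1 + m) =
      1 / ((κ + 1 + m) * harmonicDiff κ (c + 1)) := by
    rw [zero_add, div_div, mul_comm]
  rw [h2] at h
  exact h.congr fun n => by ring

end IsLastBucketSequence

end Convergence

/-! ### From convergence of the masses to convergence in distribution. -/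

lemma integral_eq_sum_of_ae_mem {ν : Measure ℕ} [IsFiniteMeasure ν] {s : Finset ℕ}
    (hs : ∀ᵐ x ∂ν, x ∈ s) (f : ℕ → ℝ) : ∫ x, f x ∂ν = ∑ m ∈ s, ν.real {m} * f m := by
  have h : ν.restrict (s : Set ℕ) = ν := Measure.restrict_eq_self_of_ae_mem (by simpa using hs)
  have hi : IntegrableOn f s ν := IntegrableOn.finset
  conv_lhs => rw [← h]
  rw [setIntegral_finset s hi]
  rfl

/-- All laws live on one finite set, so each test integral is a finite sum and pointwise convergence
of the masses suffices. -/
lemma tendstoInDistribution_of_tendsto_real {Ω : ℕ → Type*} [∀ n, MeasurableSpace (Ω n)]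
    {X : ∀ n, Ω n → ℕ} {μ : ∀ n, Measure (Ω n)} [∀ n, IsProbabilityMeasure (μ n)]
    {s : Finset ℕ} (hX : ∀ n, Measurable (X n)) (hmem : ∀ n ω, X n ω ∈ s) {K : PMF ℕ}
    (hK : K.support ⊆ s)
    (h : ∀ m ∈ s, Tendsto (fun n => (μ n).real {ω | X n ω = m}) atTop (𝓝 (K m).toReal)) :
    TendstoInDistribution X atTop (fun k : ℕ => k) μ K.toMeasure where
  forall_aemeasurable n := (hX n).aemeasurable
  aemeasurable_limit := aemeasurable_id
  tendsto := by
    refine ProbabilityMeasure.tendsto_iff_forall_integral_tendsto.2 fun f => ?_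
    have h1 : ∀ n, ∫ x, f x ∂((μ n).map (X n)) =
        ∑ m ∈ s, (μ n).real {ω | X n ω = m} * f m := by
      intro n
      have := Measure.isProbabilityMeasure_map (μ := μ n) (hX n).aemeasurable
      rw [integral_eq_sum_of_ae_mem (s := s)]
      · refine sum_congr rfl fun m _ => ?_
        rw [map_measureReal_apply (hX n) (measurableSet_singleton m)]
        rfl
      · exact (ae_map_iff (hX n).aemeasurable s.measurableSet).2 (Eventually.of_forall (hmem n))
    have h2 : ∫ x, f x ∂(K.toMeasure.map fun k : ℕ => k) = ∑ m ∈ s, (K m).toReal * f m := by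
      rw [Measure.map_id', integral_eq_sum_of_ae_mem (s := s)]
      · refine sum_congr rfl fun m _ => ?_
        rw [measureReal_def, PMF.toMeasure_apply_singleton _ _ (measurableSet_singleton m)]
      · have := (PMF.toMeasure_apply_eq_one_iff K s.measurableSet).2 hK
        exact (prob_compl_eq_zero_iff s.measurableSet).2 this
    simp only [ProbabilityMeasure.coe_mk, h1, h2]
    exact tendsto_finsetSum s fun m hm => (h m hm).mul_const _

section LimitLaw

variable {b : ℕ} {κ : ℝ}

lemma limitMass_nonneg (hb : 1 ≤ b) (hκ : -1 < κ) {m : ℕ} (hm : m ∈ Icc 1 b) :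
    0 ≤ limitMass b κ m := by
  obtain ⟨h1, h2⟩ := mem_Icc.1 hm
  obtain ⟨k, rfl⟩ : ∃ k, m = k + 1 := ⟨m - 1, by omega⟩
  rw [limitMass_eq hκ h2]
  exact one_div_nonneg.2
    (mul_nonneg (add_one_add_natCast_pos hκ k).le (harmonicDiff_pos hκ hb).le)

lemma sum_limitMass (hb : 1 ≤ b) (hκ : -1 < κ) : ∑ m ∈ Icc 1 b, limitMass b κ m = 1 := by
  have h : ∑ m ∈ range b, limitMass b κ (m + 1) = ∑ m ∈ Icc 1 b, limitMass b κ m := by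
    rw [range_eq_Ico]
    exact sum_Ico_add' (limitMass b κ) 0 b 1
  rw [← h, sum_congr rfl fun m hm => limitMass_eq hκ (mem_range.1 hm)]
  simp only [← div_div]
  rw [← sum_div, ← harmonicDiff_eq_sum_range, div_self (harmonicDiff_pos hκ hb).ne']

/-- The limit law of the last bucket size. -/
noncomputable def limitLaw (hb : 1 ≤ b) (hκ : -1 < κ) : PMF ℕ :=
  PMF.ofFinset (fun m => if m ∈ Icc 1 b then ENNReal.ofReal (limitMass b κ m) else 0) (Icc 1 b)
    (by
      rw [sum_congr rfl fun m hm => if_pos hm,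
        ← ENNReal.ofReal_sum_of_nonneg fun m hm => limitMass_nonneg hb hκ hm,
        sum_limitMass hb hκ, ENNReal.ofReal_one])
    (fun _ hm => if_neg hm)

lemma support_limitLaw_subset (hb : 1 ≤ b) (hκ : -1 < κ) :
    (limitLaw hb hκ).support ⊆ (Icc 1 b : Finset ℕ) := by
  intro m hm
  rw [PMF.mem_support_iff] at hm
  by_contra h
  exact hm (if_neg h)

lemma limitLaw_apply_toReal (hb : 1 ≤ b) (hκ : -1 < κ) {m : ℕ} (hm : m ∈ Icc 1 b) :
    (limitLaw hb hκ m).toReal = limitMass b κ m := by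
  rw [limitLaw, PMF.ofFinset_apply, if_pos hm, ENNReal.toReal_ofReal (limitMass_nonneg hb hκ hm)]

lemma IsLastBucketSequence.exists_limit {q : ℕ → ℕ → ℝ} (hq : IsLastBucketSequence b κ q)
    (hb : 1 ≤ b) (hκ : -1 < κ) (μ : ∀ n, PMF (BucketTree b (n + 1)))
    (hμ : ∀ n m, (μ n).toMeasure.real {T | T.lastBucketSize = m} = q n m) :
    ∃ K : PMF ℕ, K.support ⊆ Set.Icc 1 b ∧
      (∀ m : ℕ, 1 ≤ m → m ≤ b → (K m).toReal = limitMass b κ m) ∧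
      TendstoInDistribution
        (fun (n : ℕ) (T : BucketTree b (n - 1 + 1)) => T.lastBucketSize) atTop
        (fun k : ℕ => k) (fun n => (μ (n - 1)).toMeasure) K.toMeasure := by
  have hsupp := support_limitLaw_subset hb hκ
  refine ⟨limitLaw hb hκ, by simpa using hsupp,
    fun m h1 h2 => limitLaw_apply_toReal hb hκ (mem_Icc.2 ⟨h1, h2⟩),
    tendstoInDistribution_of_tendsto_real (s := Icc 1 b) (fun n => measurable_from_top)
      (fun n T => T.lastBucketSize_mem_Icc) hsupp fun m hm => ?_⟩
  rw [limitLaw_apply_toReal hb hκ hm]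
  simp only [hμ]
  obtain ⟨h1, h2⟩ := mem_Icc.1 hm
  obtain ⟨k, rfl⟩ : ∃ k, m = k + 1 := ⟨m - 1, by omega⟩
  -- The tree of size `n` has index `n - 1` in `q`; the value at `n = 0` plays no role in the limit.
  exact (hq.tendsto_limitMass hb hκ h2).comp (tendsto_sub_atTop_nat 1)

lemma IsLastBucketSequence.eq_sum_map_rootTerm {q : ℕ → ℕ → ℝ} (hq : IsLastBucketSequence b κ q)
    (hκ : -1 < κ) (hnd : (indicialPoly b κ).roots.Nodup) {n m : ℕ} (hn : 1 ≤ n) (hm : 1 ≤ m)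
    (hmb : m ≤ b) :
    ((q (n - 1) m : ℝ) : ℂ) = ((indicialPoly b κ).roots.map (rootTerm b κ n m)).sum := by
  obtain ⟨n, rfl⟩ : ∃ k, n = k + 1 := ⟨n - 1, by omega⟩
  obtain ⟨m, rfl⟩ : ∃ k, m = k + 1 := ⟨m - 1, by omega⟩
  rw [Nat.add_sub_cancel, hq.eq_sum_rootTerm (by omega) hκ hnd n m hmb, Finset.sum,
    Multiset.toFinset_val, hnd.dedup]

end LimitLaw

/-! ### The two growth rules as instances of the recurrence. -/

namespace BucketTree

variable {b : ℕ}

theorem isLastBucketSequence_daryRule (hb : 1 ≤ b) {d : ℕ} (hd : 2 ≤ d) :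
    IsLastBucketSequence b (1 / ((d : ℝ) - 1)) (lastBucketProb b (daryRule d)) := by
  have hd' : (0 : ℝ) < (d : ℝ) - 1 := by
    have : (2 : ℝ) ≤ d := by exact_mod_cast hd
    linarith
  have hκ : 0 < 1 / ((d : ℝ) - 1) := one_div_pos.2 hd'
  refine isLastBucketSequence_lastBucketProb hb (by linarith) (fun n c => ?_)
    fun n T => sum_daryRule hd T
  have h : (c + 1 / ((d : ℝ) - 1)) / (n + 1 + 1 / ((d : ℝ) - 1)) =
      (((d : ℝ) - 1) * (c + 1 / ((d : ℝ) - 1))) /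
        (((d : ℝ) - 1) * (n + 1 + 1 / ((d : ℝ) - 1))) :=
    (mul_div_mul_left _ _ hd'.ne').symm
  rw [h, daryRule, mul_add, mul_add ((d : ℝ) - 1) ((n : ℝ) + 1), mul_one_div_cancel hd'.ne']
  simp

lemma neg_one_lt_neg_one_div {α : ℝ} (hα : 0 < α) : -1 < -(1 / (α + 1)) := by
  rw [neg_lt_neg_iff, div_lt_one (by linarith)]
  linarith

theorem isLastBucketSequence_portRule (hb : 1 ≤ b) {α : ℝ} (hα : 0 < α) :
    IsLastBucketSequence b (-(1 / (α + 1))) (lastBucketProb b (portRule α)) := by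
  have hα' : 0 < α + 1 := by linarith
  refine isLastBucketSequence_lastBucketProb hb (neg_one_lt_neg_one_div hα) (fun n c => ?_)
    fun n T => sum_portRule hα T
  have h : (c + -(1 / (α + 1))) / (n + 1 + -(1 / (α + 1))) =
      ((α + 1) * (c + -(1 / (α + 1)))) / ((α + 1) * (n + 1 + -(1 / (α + 1)))) :=
    (mul_div_mul_left _ _ hα'.ne').symm
  rw [h, portRule, mul_add, mul_add (α + 1) ((n : ℝ) + 1), mul_neg, mul_one_div_cancel hα'.ne']
  push_cast
  ring

end BucketTree

theorem mainTheorem2 (b : ℕ) (hb : 1 ≤ b) :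
    -- `(b,d)`-ary increasing trees
    (∀ (d : ℕ) (hd : 2 ≤ d),
      (indicialPoly b (1 / ((d : ℝ) - 1))).roots.Nodup ∧
      (∀ n m : ℕ, 1 ≤ n → 1 ≤ m → m ≤ b →
        (((BucketTree.daryLaw b d hb hd (n - 1)).toMeasure.real
            {T | T.lastBucketSize = m} : ℝ) : ℂ) =
          ((indicialPoly b (1 / ((d : ℝ) - 1))).roots.map
            (rootTerm b (1 / ((d : ℝ) - 1)) n m)).sum) ∧
      ∃ K : PMF ℕ,
        K.support ⊆ Set.Icc 1 b ∧
        (∀ m : ℕ, 1 ≤ m → m ≤ b → (K m).toReal = limitMass b (1 / ((d : ℝ) - 1)) m) ∧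
        TendstoInDistribution
          (fun (n : ℕ) (T : BucketTree b (n - 1 + 1)) => T.lastBucketSize) atTop
          (fun k : ℕ => k)
          (fun n => (BucketTree.daryLaw b d hb hd (n - 1)).toMeasure) K.toMeasure) ∧
    -- `(b,α)`-plane oriented recursive trees
    (∀ (α : ℝ) (hα : 0 < α),
      (1 ≤ α → (indicialPoly b (-(1 / (α + 1)))).roots.Nodup) ∧
      ((indicialPoly b (-(1 / (α + 1)))).roots.Nodup →
        ∀ n m : ℕ, 1 ≤ n → 1 ≤ m → m ≤ b →
          (((BucketTree.portLaw b α hb hα (n - 1)).toMeasure.real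
              {T | T.lastBucketSize = m} : ℝ) : ℂ) =
            ((indicialPoly b (-(1 / (α + 1)))).roots.map
              (rootTerm b (-(1 / (α + 1))) n m)).sum) ∧
      ∃ K : PMF ℕ,
        K.support ⊆ Set.Icc 1 b ∧
        (∀ m : ℕ, 1 ≤ m → m ≤ b → (K m).toReal = limitMass b (-(1 / (α + 1))) m) ∧
        TendstoInDistribution
          (fun (n : ℕ) (T : BucketTree b (n - 1 + 1)) => T.lastBucketSize) atTop
          (fun k : ℕ => k)
          (fun n => (BucketTree.portLaw b α hb hα (n - 1)).toMeasure) K.toMeasure) ∧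
    {α : ℝ | 0 < α ∧ ¬ (indicialPoly b (-(1 / (α + 1)))).roots.Nodup}.Finite := by
  refine ⟨fun d hd => ?_, fun α hα => ?_, ?_⟩
  · have hκ : 0 < 1 / ((d : ℝ) - 1) := by
      have : (2 : ℝ) ≤ d := by exact_mod_cast hd
      exact one_div_pos.2 (by linarith)
    have hq := BucketTree.isLastBucketSequence_daryRule hb hd
    have hlaw : ∀ n m, (BucketTree.daryLaw b d hb hd n).toMeasure.real
        {T | T.lastBucketSize = m} = BucketTree.lastBucketProb b (BucketTree.daryRule d) n m :=
      fun n m => BucketTree.real_ofFintype_lastBucketSize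
        (fun T => (BucketTree.growthMass_daryRule_nonneg hd n T).1) _ m
    have hnd := nodup_roots_indicialPoly (b := b) (by linarith : -(1 / 2) ≤ 1 / ((d : ℝ) - 1)) hb
    refine ⟨hnd, fun n m hn hm hmb => ?_, hq.exists_limit hb (by linarith) _ hlaw⟩
    rw [hlaw]
    exact hq.eq_sum_map_rootTerm (by linarith) hnd hn hm hmb
  · have hκ := BucketTree.neg_one_lt_neg_one_div hα
    have hq := BucketTree.isLastBucketSequence_portRule hb hα
    have hlaw : ∀ n m, (BucketTree.portLaw b α hb hα n).toMeasure.real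
        {T | T.lastBucketSize = m} = BucketTree.lastBucketProb b (BucketTree.portRule α) n m :=
      fun n m => BucketTree.real_ofFintype_lastBucketSize
        (fun T => BucketTree.growthMass_portRule_nonneg hα n T) _ m
    refine ⟨fun h1 => nodup_roots_indicialPoly ?_ hb, fun hnd n m hn hm hmb => ?_,
      hq.exists_limit hb hκ _ hlaw⟩
    -- The condition `α ≥ 1` amounts to `κ ≥ -1/2`.
    · exact neg_le_neg (one_div_le_one_div_of_le (by norm_num) (by linarith))
    · rw [hlaw]
      exact hq.eq_sum_map_rootTerm hκ hnd hn hm hmb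
  · refine Set.Finite.of_finite_image (f := fun α : ℝ => -(1 / (α + 1)))
      ((finite_not_nodup_roots_indicialPoly hb).subset ?_) ?_
    · rintro _ ⟨α, ⟨hα, hnd⟩, rfl⟩
      exact ⟨BucketTree.neg_one_lt_neg_one_div hα, hnd⟩
    · intro α _ β _ h
      simpa using h
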